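/- **Conventions.** ZFA is Zermelo–Fraenkel set theory with extensionality weakened to allow a set of atoms; ZF is ZFA without atoms. Consider the following principles. - $\mathsf{OP}$: every set can be linearly ordered. - $\mathsf{RT}^{4}_{203}$: for every infinite set $X$ and every $\chi:[X]^{4}\to 203$ there is an infinite $Y\subseteq X$ such that $\chi$ is constant on $[Y]^{4}$. - $\mathsf{DF=F}$: every Dedekind-finite set (a set $X$ with no one-to-one function $\omega\to X$) is finite. - $\mathsf{CRT}$: for every infinite set $X$ and every $f:[X]^{2}\to C$ there are an infinite $Y\subseteq X$ and a strict linear ordering $R$ of $Y$ such that one of the following holds for all $a_1,b_1,a_2,b_2\in Y$ with $a_1Rb_1$ and $a_2Rb_2$: (a) always $f(\{a_1,b_1\})=f(\{a_2,b_2\})$; (b) $f(\{a_1,b_1\})=f(\{a_2,b_2\})$ iff $a_1=a_2$; (c) $f(\{a_1,b_1\})=f(\{a_2,b_2\})$ iff $b_1=b_2$; (d) $f(\{a_1,b_1\})=f(\{a_2,b_2\})$ iff $a_1=a_2$ and $b_1=b_2$. Mostowski's linearly ordered model $\mathcal N_3$ is the permutation model built as follows. Let $A$ be a set of atoms with a linear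 order isomorphic to $(\mathbb{Q},<)$, let $V(A)$ be the universe of all sets over the atoms $A$, and let $\mathcal G$ be the group of all order automorphisms of $A$, acting on $V(A)$ by $g(x)=\{g(y):y\in x\}$. Then $\mathcal N_3$ consists of those $x\in V(A)$ such that for every $t$ in the transitive closure of $\{x\}$ there is a finite $E\subseteq A$ such that every $g\in\mathcal G$ fixing $E$ pointwise satisfies $g(t)=t$. **Theorem.** 1. In ZF, $\mathsf{OP}+\mathsf{RT}^{4}_{203}$ implies $\mathsf{CRT}$; that is, every model of $\mathrm{ZF}+\mathsf{OP}+\mathsf{RT}^{4}_{203}$ satisfies $\mathsf{CRT}$. 2. In ZFA, $\mathsf{DF=F}$ is strictly stronger than $\mathsf{CRT}$: every model of $\mathrm{ZFA}+\mathsf{DF=F}$ satisfies $\mathsf{CRT}$, whereas $\mathcal N_3$ is a model of ZFA in which $\mathsf{CRT}$ holds and $\mathsf{DF=F}$ fails. -/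

import Mathlib

universe u v

/-! ## Structures for set theory with atoms -/

/-- A structure for the language of set theory with atoms: a binary membership relation and a
unary predicate "is an atom". -/
class SetStructure (M : Type u) where
  mem : M → M → Prop
  isAtom : M → Prop

namespace SetStructure

infix:50 " ∈ₘ " => SetStructure.mem

/-- The relation symbols of the first-order language of set theory with atoms. -/
inductive Rels : ℕ → Type
  | mem : Rels 2
  | atom : Rels 1

/-- The first-order language with a binary symbol for membership and a unary symbol for atoms. -/
def lang : FirstOrder.Language := ⟨fun _ => Empty, Rels⟩

instance langStructure (M : Type u) [SetStructure M] : lang.Structure M where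
  funMap := fun f => Empty.elim f
  RelMap := fun {_} r => match r with
    | .mem => fun v => mem (v 0) (v 1)
    | .atom => fun v => isAtom (v 0)

section
variable {M : Type u} [SetStructure M]

/-! ### Basic set-theoretic vocabulary, evaluated inside a structure

Every quantifier below ranges over the elements of the structure `M`. -/

/-- `x` is a set, that is, not an atom. -/
def IsSet (x : M) : Prop := ¬ isAtom x

/-- `x ⊆ y`. -/
def Sub (x y : M) : Prop := ∀ z, z ∈ₘ x → z ∈ₘ y

/-- `x = ∅`. -/
def IsEmptySet (x : M) : Prop := IsSet x ∧ ∀ z, ¬ z ∈ₘ x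

/-- `x = {a, b}`. -/
def IsUPair (x a b : M) : Prop := IsSet x ∧ ∀ z, z ∈ₘ x ↔ z = a ∨ z = b

/-- `p` is the Kuratowski ordered pair `(a, b) = {{a}, {a, b}}`. -/
def IsPair (p a b : M) : Prop := IsSet p ∧ ∀ z, z ∈ₘ p ↔ IsUPair z a a ∨ IsUPair z a b

/-- `y = x ∪ {x}`. -/
def IsSucc (y x : M) : Prop := IsSet y ∧ ∀ z, z ∈ₘ y ↔ z ∈ₘ x ∨ z = x

/-- `I` is an inductive set: it contains `∅` and is closed under `x ↦ x ∪ {x}`. -/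
def IsInductive (I : M) : Prop :=
  (∃ e, IsEmptySet e ∧ e ∈ₘ I) ∧ ∀ x, x ∈ₘ I → ∃ y, IsSucc y x ∧ y ∈ₘ I

/-- `n` is a natural number of `M`: it lies in every inductive set of `M`. -/
def IsNat (n : M) : Prop := ∀ I : M, IsInductive I → n ∈ₘ I

/-- `w = ω`. -/
def IsOmega (w : M) : Prop := IsSet w ∧ ∀ n, n ∈ₘ w ↔ IsNat n

/-- `x` is the von Neumann numeral `n = {0, …, n - 1}`. -/
def IsNumeral : ℕ → M → Prop
  | 0, x => IsEmptySet x
  | n + 1, x => ∃ y, IsNumeral n y ∧ IsSucc x y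

/-- The ordered pair `(a, b)` is an element of `r`. -/
def Rel (r a b : M) : Prop := ∃ p, p ∈ₘ r ∧ IsPair p a b

/-- `r` is a set of ordered pairs with `r ⊆ x × y`. -/
def IsRelation (r x y : M) : Prop :=
  IsSet r ∧ ∀ p, p ∈ₘ r → ∃ a b, a ∈ₘ x ∧ b ∈ₘ y ∧ IsPair p a b

/-- `f` is a function from `x` to `y`. Then `Rel f a b` says `f(a) = b`. -/
def IsFun (f x y : M) : Prop := IsRelation f x y ∧ ∀ a, a ∈ₘ x → ∃! b, Rel f a b

/-- `f` is a one-to-one function from `x` to `y`. -/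
def IsInj (f x y : M) : Prop :=
  IsFun f x y ∧ ∀ a a' b, Rel f a b → Rel f a' b → a = a'

/-- `f` is a bijection from `x` onto `y`. -/
def IsBij (f x y : M) : Prop := IsInj f x y ∧ ∀ b, b ∈ₘ y → ∃ a, Rel f a b

/-- `x` is finite: it is in bijection with a natural number (all in the sense of `M`). -/
def IsFinite (x : M) : Prop := ∃ n f, IsNat n ∧ IsBij f n x

/-- `x` is Dedekind-finite: there is no one-to-one function from `ω` to `x`. -/
def IsDedekindFinite (x : M) : Prop := ¬ ∃ w f, IsOmega w ∧ IsInj f w x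

/-- `P = [X]^m`, the set of all `m`-element subsets of `X`. -/
def IsSubsetsOfSize (m : ℕ) (X P : M) : Prop :=
  IsSet P ∧ ∀ s, s ∈ₘ P ↔ IsSet s ∧ Sub s X ∧ ∃ k f, IsNumeral m k ∧ IsBij f k s

/-- `R` is a (strict) linear ordering of `X`. -/
def IsLinearOrdering (R X : M) : Prop :=
  IsRelation R X X ∧ (∀ a, ¬ Rel R a a) ∧
    (∀ a b c, Rel R a b → Rel R b c → Rel R a c) ∧
    ∀ a b, a ∈ₘ X → b ∈ₘ X → Rel R a b ∨ a = b ∨ Rel R b a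

/-- `f({a₁, b₁}) = f({a₂, b₂})`. -/
def SameColor (f a₁ b₁ a₂ b₂ : M) : Prop :=
  ∃ s₁ s₂ c, IsUPair s₁ a₁ b₁ ∧ IsUPair s₂ a₂ b₂ ∧ Rel f s₁ c ∧ Rel f s₂ c

end

section
variable (M : Type u) [SetStructure M]

/-! ### The theories -/

/-- `M` is a model of ZFA. The two schemes are stated for all first-order definable (with
parameters from `M`) properties in the language with membership and the predicate for atoms. -/
structure IsZFA : Prop where
  /-- Atoms have no elements. -/
  atom_empty : ∀ a x : M, isAtom a → ¬ x ∈ₘ a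
  /-- The atoms form a set. -/
  atoms : ∃ A : M, IsSet A ∧ ∀ z, z ∈ₘ A ↔ isAtom z
  /-- Extensionality, for sets. -/
  extensionality : ∀ x y : M, IsSet x → IsSet y → (∀ z, z ∈ₘ x ↔ z ∈ₘ y) → x = y
  pairing : ∀ a b : M, ∃ x, IsUPair x a b
  union : ∀ x : M, ∃ y, IsSet y ∧ ∀ z, z ∈ₘ y ↔ ∃ w, w ∈ₘ x ∧ z ∈ₘ w
  power : ∀ x : M, ∃ y, IsSet y ∧ ∀ z, z ∈ₘ y ↔ IsSet z ∧ Sub z x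
  infinity : ∃ I : M, IsSet I ∧ IsInductive I
  foundation : ∀ x : M, (∃ y, y ∈ₘ x) → ∃ y, y ∈ₘ x ∧ ∀ z, z ∈ₘ y → ¬ z ∈ₘ x
  separation : ∀ S : Set M, (Set.univ : Set M).Definable₁ lang S →
    ∀ x : M, ∃ y, IsSet y ∧ ∀ z, z ∈ₘ y ↔ z ∈ₘ x ∧ z ∈ S
  replacement : ∀ F : Set (M × M), (Set.univ : Set M).Definable₂ lang F →
    ∀ x : M, (∀ a b b', a ∈ₘ x → (a, b) ∈ F → (a, b') ∈ F → b = b') →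
      ∃ y, IsSet y ∧ ∀ b, b ∈ₘ y ↔ ∃ a, a ∈ₘ x ∧ (a, b) ∈ F

/-- `M` is a model of ZF: a model of ZFA without atoms. (The symbol for atoms then denotes the
empty class, so that it adds nothing to the language of membership.) -/
def IsZF : Prop := IsZFA M ∧ ∀ a : M, ¬ isAtom a

/-! ### The principles -/

/-- The Ordering Principle: every set can be linearly ordered. -/
def OP : Prop := ∀ X : M, IsSet X → ∃ R, IsLinearOrdering R X

/-- `DF = F`: every Dedekind-finite set is finite. -/
def DFeqF : Prop := ∀ X : M, IsSet X → IsDedekindFinite X → IsFinite X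

/-- Ramsey's Theorem for `m`-element sets and `n` colors: for every infinite `X` and every
`f : [X]^m → n` there is an infinite `Y ⊆ X` with `f` constant on `[Y]^m`. -/
def RT (m n : ℕ) : Prop :=
  ∀ X P k f : M, IsSet X → ¬ IsFinite X → IsSubsetsOfSize m X P → IsNumeral n k → IsFun f P k →
    ∃ Y, IsSet Y ∧ Sub Y X ∧ ¬ IsFinite Y ∧
      ∀ s t c d, s ∈ₘ P → t ∈ₘ P → Sub s Y → Sub t Y → Rel f s c → Rel f t d → c = d

/-- The Canonical Ramsey Theorem for pairs: for every infinite `X` and every `f : [X]^2 → C` there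
are an infinite `Y ⊆ X` and a linear ordering `R` of `Y` such that `f` on `[Y]^2` is constant, or
depends exactly on the smaller element, or exactly on the larger element, or is one-to-one. -/
def CRT : Prop :=
  ∀ X P C f : M, IsSet X → ¬ IsFinite X → IsSubsetsOfSize 2 X P → IsSet C → IsFun f P C →
    ∃ Y R, IsSet Y ∧ Sub Y X ∧ ¬ IsFinite Y ∧ IsLinearOrdering R Y ∧
      ((∀ a₁ b₁ a₂ b₂, Rel R a₁ b₁ → Rel R a₂ b₂ → SameColor f a₁ b₁ a₂ b₂) ∨
       (∀ a₁ b₁ a₂ b₂, Rel R a₁ b₁ → Rel R a₂ b₂ → (SameColor f a₁ b₁ a₂ b₂ ↔ a₁ = a₂)) ∨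
       (∀ a₁ b₁ a₂ b₂, Rel R a₁ b₁ → Rel R a₂ b₂ → (SameColor f a₁ b₁ a₂ b₂ ↔ b₁ = b₂)) ∨
       (∀ a₁ b₁ a₂ b₂, Rel R a₁ b₁ → Rel R a₂ b₂ →
          (SameColor f a₁ b₁ a₂ b₂ ↔ a₁ = a₂ ∧ b₁ = b₂)))

end

end SetStructure

/-! ## The universe of sets over a collection of atoms -/

/-- Names for the sets built over the atoms `A`: a name is an atom, or a family of names indexed
by a type in the universe of `A`. -/
inductive PreASet (A : Type u) : Type (u + 1)
  | atom (a : A) : PreASet A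
  | mk (ι : Type u) (x : ι → PreASet A) : PreASet A

namespace PreASet

variable {A : Type u}

/-- Extensional equality of names. -/
def Equiv : PreASet A → PreASet A → Prop
  | .atom a, .atom b => a = b
  | .mk _ x, .mk _ y => (∀ i, ∃ j, Equiv (x i) (y j)) ∧ ∀ j, ∃ i, Equiv (x i) (y j)
  | .atom _, .mk _ _ => False
  | .mk _ _, .atom _ => False

theorem Equiv.refl : ∀ x : PreASet A, Equiv x x
  | .atom a => by simp [Equiv]
  | .mk _ x => by
    rw [Equiv]
    exact ⟨fun i => ⟨i, Equiv.refl (x i)⟩, fun i => ⟨i, Equiv.refl (x i)⟩⟩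

theorem Equiv.symm : ∀ {x y : PreASet A}, Equiv x y → Equiv y x
  | .atom a, .atom b, h => by rw [Equiv] at h ⊢; exact h.symm
  | .mk _ x, .mk _ y, h => by
    rw [Equiv] at h ⊢
    exact ⟨fun j => (h.2 j).imp fun _ => Equiv.symm, fun i => (h.1 i).imp fun _ => Equiv.symm⟩
  | .atom _, .mk _ _, h => by simp [Equiv] at h
  | .mk _ _, .atom _, h => by simp [Equiv] at h

theorem Equiv.trans : ∀ {x y z : PreASet A}, Equiv x y → Equiv y z → Equiv x z
  | .atom a, .atom b, .atom c, h, k => by rw [Equiv] at h k ⊢; exact h.trans k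
  | .mk _ x, .mk _ y, .mk _ z, h, k => by
    rw [Equiv] at h k ⊢
    refine ⟨fun i => ?_, fun l => ?_⟩
    · obtain ⟨j, hj⟩ := h.1 i
      obtain ⟨l, hl⟩ := k.1 j
      exact ⟨l, Equiv.trans hj hl⟩
    · obtain ⟨j, hj⟩ := k.2 l
      obtain ⟨i, hi⟩ := h.2 j
      exact ⟨i, Equiv.trans hi hj⟩
  | .atom _, .mk _ _, _, h, _ => by simp [Equiv] at h
  | .mk _ _, .atom _, _, h, _ => by simp [Equiv] at h
  | .atom _, .atom _, .mk _ _, _, k => by simp [Equiv] at k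
  | .mk _ _, .mk _ _, .atom _, _, k => by simp [Equiv] at k

instance setoid (A : Type u) : Setoid (PreASet A) :=
  ⟨Equiv, Equiv.refl, Equiv.symm, Equiv.trans⟩

/-- Membership of names. Atoms have no members. -/
def Mem (x : PreASet A) : PreASet A → Prop
  | .atom _ => False
  | .mk _ y => ∃ i, Equiv x (y i)

/-- The name is an atom. -/
def IsAtom : PreASet A → Prop
  | .atom _ => True
  | .mk _ _ => False

/-- A permutation `g` of the atoms acts on names: `g(x) = {g(y) : y ∈ x}`. -/
def act (g : Equiv.Perm A) : PreASet A → PreASet A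
  | .atom a => .atom (g a)
  | .mk ι x => .mk ι fun i => act g (x i)

theorem mem_congr : ∀ {x x' y y' : PreASet A}, Equiv x x' → Equiv y y' → (Mem x y ↔ Mem x' y')
  | _, _, .atom _, .atom _, _, _ => Iff.rfl
  | _, _, .mk _ y, .mk _ y', hx, hy => by
    rw [Equiv] at hy
    constructor
    · rintro ⟨i, hi⟩
      obtain ⟨j, hj⟩ := hy.1 i
      exact ⟨j, (hx.symm.trans hi).trans hj⟩
    · rintro ⟨j, hj⟩
      obtain ⟨i, hi⟩ := hy.2 j
      exact ⟨i, (hx.trans hj).trans hi.symm⟩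
  | _, _, .atom _, .mk _ _, _, h => by simp [Equiv] at h
  | _, _, .mk _ _, .atom _, _, h => by simp [Equiv] at h

theorem isAtom_congr : ∀ {x y : PreASet A}, Equiv x y → (IsAtom x ↔ IsAtom y)
  | .atom _, .atom _, _ => Iff.rfl
  | .mk _ _, .mk _ _, _ => Iff.rfl
  | .atom _, .mk _ _, h => by simp [Equiv] at h
  | .mk _ _, .atom _, h => by simp [Equiv] at h

theorem act_congr (g : Equiv.Perm A) : ∀ {x y : PreASet A}, Equiv x y → Equiv (act g x) (act g y)
  | .atom _, .atom _, h => by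
    rw [Equiv] at h
    rw [h]
    exact Equiv.refl _
  | .mk _ x, .mk _ y, h => by
    rw [Equiv] at h
    rw [act, act, Equiv]
    exact ⟨fun i => (h.1 i).imp fun _ => act_congr g, fun j => (h.2 j).imp fun _ => act_congr g⟩
  | .atom _, .mk _ _, h => by simp [Equiv] at h
  | .mk _ _, .atom _, h => by simp [Equiv] at h

end PreASet

/-- The universe of all atoms and sets built over the atoms `A`: names up to extensional equality. -/
def ASet (A : Type u) : Type (u + 1) := Quotient (PreASet.setoid A)

namespace ASet

variable {A : Type u}

instance setStructure (A : Type u) : SetStructure (ASet A) where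
  mem := Quotient.lift₂ PreASet.Mem fun _ _ _ _ h k => propext (PreASet.mem_congr h k)
  isAtom := Quotient.lift PreASet.IsAtom fun _ _ h => propext (PreASet.isAtom_congr h)

/-- The action of a permutation of the atoms on the universe. -/
def act (g : Equiv.Perm A) : ASet A → ASet A :=
  Quotient.map (PreASet.act g) fun _ _ h => PreASet.act_congr g h

/-- The finite set `E` of atoms is a support of `x`: every order automorphism of `A` that fixes
`E` pointwise fixes `x`. -/
def IsSupport [LinearOrder A] (E : Finset A) (x : ASet A) : Prop :=
  ∀ g : A ≃o A, (∀ a ∈ E, g a = a) → act g.toEquiv x = x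

/-- `x` is hereditarily symmetric: every `t` in the transitive closure of `{x}` has a finite
support. -/
def IsHereditarilySymmetric [LinearOrder A] (x : ASet A) : Prop :=
  ∀ t : ASet A, Relation.ReflTransGen (fun y z : ASet A => y ∈ₘ z) t x →
    ∃ E : Finset A, IsSupport E t

end ASet

/-- The permutation model determined by the linearly ordered set `A` of atoms, the group of its
order automorphisms, and finite supports. When `A` is ordered like the rationals, it is Mostowski's
linearly ordered model. -/
def MostowskiModel (A : Type u) [LinearOrder A] : Type (u + 1) :=
  {x : ASet A // ASet.IsHereditarilySymmetric x}

instance MostowskiModel.setStructure (A : Type u) [LinearOrder A] :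
    SetStructure (MostowskiModel A) where
  mem := fun x y => x.1 ∈ₘ y.1
  isAtom := fun x => SetStructure.isAtom x.1

/-! A coloring of pairs is used only through the equivalence relation "same color" on pairs. Two
distinct pairs meet in one of six ways: for a < b < c they are ab/ac, ac/bc or ab/bc, and for a < b
< c < d they are ab/cd, ac/bd or ad/bc. If for each of these six patterns the truth value of "same
color" does not depend on the chosen points, then five points suffice to show that the coloring is
constant, depends exactly on the smaller end, depends exactly on the larger end, or is one-to-one
(`canonical_of_hom`). So the canonical theorem reduces to finding an infinite linearly ordered set
on which the six patterns are constant (`hasCanonicalSubset_of_patternOn`). There are three sources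
of such sets.

With a linear ordering of X and Ramsey's theorem for 4-sets, color each 4-set by the truth value of
one pattern on its increasing enumeration, and thin X once per pattern (`crt_of_op_of_rt`). The
number 203 counts the equivalence relations on the six pairs of a 4-set, which would settle all
patterns at once. Treating them one at a time needs only two colors.

If X is Dedekind-infinite, pull the coloring back to ω. There Ramsey's theorem for quadruples is
provable without choice, by the usual end-homogeneous set built by recursion
(`exists_endHomogeneous`, `exists_homOn_unbounded`). This gives CRT from DF=F. Since the ω of an
arbitrary model may be nonstandard, every induction and recursion is carried out inside the model,
for definable properties only.

In Mostowski's model, let E support X and the coloring. If every element of X is supported by E,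
then X is Dedekind-infinite in the model. Otherwise some x in X has a support S containing E of
least size. Pick a in S outside E. Over S without a, the orbit of x is a copy of an interval of
atoms, and any two increasing quadruples in it are conjugate by an automorphism fixing the coloring.
Hence all patterns are constant there (`hasCanonicalSubset_of_orbit`). DF=F fails because an
injection from ω into the atoms takes all its values in its own finite support. -/

open FirstOrder Language

/-! ### Definability with parameters, by instance search -/

namespace SetStructure

section Definability
variable {M : Type u} [SetStructure M]

/-- `t` is a variable or a parameter, as a function of the values of the variables. -/
class Tm {n : ℕ} (t : (Fin n → M) → M) : Prop where
  out : ∃ τ : (lang[[(Set.univ : Set M)]]).Term (Fin n), ∀ w, τ.realize w = t w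

/-- `φ` is first-order definable with parameters. -/
class D {n : ℕ} (φ : (Fin n → M) → Prop) : Prop where
  out : (Set.univ : Set M).Definable lang {w | φ w}

variable {n : ℕ}

instance Tm.proj (i : Fin n) : Tm (fun w : Fin n → M => w i) :=
  ⟨Term.var i, fun _ => rfl⟩

instance Tm.const (c : M) : Tm (fun _ : Fin n → M => c) :=
  ⟨Constants.term (lang.con (⟨c, trivial⟩ : (Set.univ : Set M))), fun w => by simp⟩

/-- Under a quantifier the old variables are shifted by one; this lets a term survive the shift. The
low priority lets plain variables and parameters be tried first. -/
instance (priority := 50) Tm.reindex {m : ℕ} (t : (Fin n → M) → M) (f : Fin n → Fin m)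
    [h : Tm t] : Tm (fun w : Fin m → M => t (fun i => w (f i))) := by
  obtain ⟨τ, hτ⟩ := h
  exact ⟨τ.relabel f, fun w => by rw [Term.realize_relabel]; exact hτ _⟩

instance D.mem (s t : (Fin n → M) → M) [hs : Tm s] [ht : Tm t] : D (fun w => s w ∈ₘ t w) := by
  obtain ⟨σ, hσ⟩ := hs
  obtain ⟨τ, hτ⟩ := ht
  refine ⟨⟨Relations.formula₂ ((lang.lhomWithConstants (Set.univ : Set M)).onRelation Rels.mem) σ τ, ?_⟩⟩
  ext w
  refine Iff.trans ?_ (Formula.realize_rel₂.trans (iff_of_eq (LHom.map_onRelation _ _ _))).symm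
  rw [hσ, hτ]
  rfl

instance D.atom (s : (Fin n → M) → M) [hs : Tm s] : D (fun w => isAtom (s w)) := by
  obtain ⟨σ, hσ⟩ := hs
  refine ⟨⟨Relations.formula₁ ((lang.lhomWithConstants (Set.univ : Set M)).onRelation Rels.atom) σ, ?_⟩⟩
  ext w
  refine Iff.trans ?_ (Formula.realize_rel₁.trans (iff_of_eq (LHom.map_onRelation _ _ _))).symm
  rw [hσ]
  rfl

instance D.eq (s t : (Fin n → M) → M) [hs : Tm s] [ht : Tm t] : D (fun w => s w = t w) := by
  obtain ⟨σ, hσ⟩ := hs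
  obtain ⟨τ, hτ⟩ := ht
  refine ⟨⟨σ.equal τ, ?_⟩⟩
  ext w
  simp [Formula.realize_equal, hσ, hτ]

instance D.prop (p : Prop) : D (fun _ : Fin n → M => p) := by
  by_cases h : p
  · exact ⟨by simp [h]⟩
  · exact ⟨by simp [h]⟩

variable (φ ψ : (Fin n → M) → Prop)

instance D.and [h : D φ] [k : D ψ] : D (fun w => φ w ∧ ψ w) := ⟨h.out.inter k.out⟩
instance D.or [h : D φ] [k : D ψ] : D (fun w => φ w ∨ ψ w) := ⟨h.out.union k.out⟩
instance D.not [h : D φ] : D (fun w => ¬ φ w) := ⟨h.out.compl⟩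

theorem D.congr {φ ψ : (Fin n → M) → Prop} (h : D φ) (e : ∀ w, φ w ↔ ψ w) : D ψ :=
  (funext fun w => propext (e w) : φ = ψ) ▸ h

instance D.imp [h : D φ] [k : D ψ] : D (fun w => φ w → ψ w) :=
  D.congr (inferInstance : D fun w => ¬ φ w ∨ ψ w) fun w => by tauto
instance D.iff [h : D φ] [k : D ψ] : D (fun w => φ w ↔ ψ w) :=
  D.congr (inferInstance : D fun w => (φ w → ψ w) ∧ (ψ w → φ w)) fun w => by tauto

/-- The bound variable is coordinate 0 of a longer tuple, so an existential quantifier is the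
projection that forgets this coordinate. -/
instance D.ex (φ : (Fin n → M) → M → Prop)
    [h : D (fun w : Fin (n + 1) → M => φ (fun i => w i.succ) (w 0))] :
    D (fun w => ∃ x, φ w x) := by
  refine ⟨?_⟩
  have := h.out.image_comp_embedding (Fin.succEmb n)
  convert this using 1
  ext w
  constructor
  · rintro ⟨x, hx⟩
    exact ⟨Fin.cons x w, by simpa using hx, by ext i; simp⟩
  · rintro ⟨v, hv, rfl⟩
    exact ⟨v 0, hv⟩

instance D.all (φ : (Fin n → M) → M → Prop)
    [h : D (fun w : Fin (n + 1) → M => φ (fun i => w i.succ) (w 0))] :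
    D (fun w => ∀ x, φ w x) :=
  D.congr (inferInstance : D fun w => ¬ ∃ x, ¬ φ w x) fun w => by push Not; rfl

/-- Covers disjunctions indexed by an external finite type, such as those over `Fin m` that describe
enumerations of finite sets. -/
instance D.exFin {ι : Type*} [Finite ι] (φ : ι → (Fin n → M) → Prop) [h : ∀ i, D (φ i)] :
    D (fun w => ∃ i, φ i w) := by
  refine ⟨?_⟩
  have := Set.definable_iUnion_of_finite fun i => (h i).out
  convert this using 1
  ext w
  simp

instance D.exUnique (φ : (Fin n → M) → M → Prop)
    [h : D (fun w => ∃ x, φ w x ∧ ∀ y, φ w y → y = x)] : D (fun w => ∃! x, φ w x) := h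

section Vocabulary
variable (a b c d e : (Fin n → M) → M) [Tm a] [Tm b] [Tm c] [Tm d] [Tm e]

instance : D (fun w => IsSet (a w)) := by unfold IsSet; infer_instance
instance : D (fun w => Sub (a w) (b w)) := by unfold Sub; infer_instance
instance : D (fun w => IsEmptySet (a w)) := by unfold IsEmptySet; infer_instance
instance : D (fun w => IsUPair (a w) (b w) (c w)) := by unfold IsUPair; infer_instance
instance : D (fun w => IsPair (a w) (b w) (c w)) := by unfold IsPair; infer_instance
instance : D (fun w => IsSucc (a w) (b w)) := by unfold IsSucc; infer_instance
instance : D (fun w => IsInductive (a w)) := by unfold IsInductive; infer_instance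
instance : D (fun w => IsNat (a w)) := by unfold IsNat; infer_instance
instance : D (fun w => IsOmega (a w)) := by unfold IsOmega; infer_instance
-- The number of variables stays general in the induction, because unfolding a successor numeral
-- introduces a new bound variable.
theorem D.isNumeral (m : ℕ) : ∀ {n : ℕ} (a : (Fin n → M) → M) [Tm a],
    D (fun w => IsNumeral m (a w)) := by
  induction m with
  | zero => intro n a _; unfold IsNumeral; infer_instance
  | succ m ih => intro n a _; unfold IsNumeral; infer_instance
instance (m : ℕ) : D (fun w => IsNumeral m (a w)) := D.isNumeral m a
instance : D (fun w => Rel (a w) (b w) (c w)) := by unfold Rel; infer_instance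
instance : D (fun w => IsRelation (a w) (b w) (c w)) := by unfold IsRelation; infer_instance
instance : D (fun w => IsFun (a w) (b w) (c w)) := by unfold IsFun; infer_instance
instance : D (fun w => IsInj (a w) (b w) (c w)) := by unfold IsInj; infer_instance
instance : D (fun w => IsBij (a w) (b w) (c w)) := by unfold IsBij; infer_instance
instance : D (fun w => IsFinite (a w)) := by unfold IsFinite; infer_instance
instance : D (fun w => SameColor (a w) (b w) (c w) (d w) (e w)) := by
  unfold SameColor; infer_instance
end Vocabulary

end Definability
end SetStructure

namespace SetStructure

section Definability
variable {M : Type u} [SetStructure M]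

/-- A definable class, stable under substitution of variables and parameters. -/
abbrev Def1 (φ : M → Prop) : Prop :=
  ∀ (n : ℕ) (a : (Fin n → M) → M) [Tm a], D (fun w => φ (a w))
/-- A definable binary relation. -/
abbrev Def2 (φ : M → M → Prop) : Prop :=
  ∀ (n : ℕ) (a b : (Fin n → M) → M) [Tm a] [Tm b], D (fun w => φ (a w) (b w))
/-- A definable ternary relation. -/
abbrev Def3 (φ : M → M → M → Prop) : Prop :=
  ∀ (n : ℕ) (a b c : (Fin n → M) → M) [Tm a] [Tm b] [Tm c], D (fun w => φ (a w) (b w) (c w))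
/-- A definable relation between four objects. -/
abbrev Def4 (φ : M → M → M → M → Prop) : Prop :=
  ∀ (n : ℕ) (a b c d : (Fin n → M) → M) [Tm a] [Tm b] [Tm c] [Tm d],
    D (fun w => φ (a w) (b w) (c w) (d w))

end Definability

/-! ### Elementary set theory inside a model of ZFA -/

namespace IsZFA
variable {M : Type u} [SetStructure M] (h : IsZFA M)
include h

/-- The default argument runs instance search, so that Separation can be used without writing
formulas. -/
theorem sep (x : M) (φ : M → Prop) (hφ : Def1 φ := by intro _ _ _; infer_instance) :
    ∃ y, IsSet y ∧ ∀ z, z ∈ₘ y ↔ z ∈ₘ x ∧ φ z :=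
  h.separation {z | φ z} (hφ 1 (fun w => w 0)).out x

theorem ext {x y : M} (hx : IsSet x) (hy : IsSet y) (k : ∀ z, z ∈ₘ x ↔ z ∈ₘ y) : x = y :=
  h.extensionality x y hx hy k

theorem upair_unique {p q a b : M} (hp : IsUPair p a b) (hq : IsUPair q a b) : p = q :=
  h.ext hp.1 hq.1 fun z => (hp.2 z).trans (hq.2 z).symm

theorem exists_pair (a b : M) : ∃ p, IsPair p a b := by
  obtain ⟨s, hs⟩ := h.pairing a a
  obtain ⟨t, ht⟩ := h.pairing a b
  obtain ⟨p, hp⟩ := h.pairing s t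
  refine ⟨p, hp.1, fun z => (hp.2 z).trans ?_⟩
  constructor
  · rintro (rfl | rfl)
    exacts [Or.inl hs, Or.inr ht]
  · exact fun k => k.imp (fun k => h.upair_unique k hs) (fun k => h.upair_unique k ht)

theorem pair_inj {p a b c d : M} (hp : IsPair p a b) (hq : IsPair p c d) : a = c ∧ b = d := by
  obtain ⟨s, hs⟩ := h.pairing a a
  obtain ⟨t, ht⟩ := h.pairing a b
  obtain ⟨s', hs'⟩ := h.pairing c c
  obtain ⟨t', ht'⟩ := h.pairing c d
  have e1 := (hq.2 s).1 ((hp.2 s).2 (Or.inl hs))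
  have e2 := (hq.2 t).1 ((hp.2 t).2 (Or.inr ht))
  have e3 := (hp.2 t').1 ((hq.2 t').2 (Or.inr ht'))
  have hac : a = c := by
    rcases e1 with e | e
    · have := (e.2 c).2 (Or.inl rfl)
      exact ((by simpa using (hs.2 c).1 this : c = a)).symm
    · have := (e.2 c).2 (Or.inl rfl)
      exact ((by simpa using (hs.2 c).1 this : c = a)).symm
  subst hac
  refine ⟨rfl, ?_⟩
  have hb : b = a ∨ b = d := by
    have := (ht.2 b).2 (Or.inr rfl)
    rcases e2 with e | e
    · exact Or.inl (by simpa using (e.2 b).1 this)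
    · exact (e.2 b).1 this
  have hd : d = a ∨ d = b := by
    have := (ht'.2 d).2 (Or.inr rfl)
    rcases e3 with e | e
    · exact Or.inl (by simpa using (e.2 d).1 this)
    · exact (e.2 d).1 this
  rcases hb with rfl | hb
  · rcases hd with rfl | hd
    · rfl
    · exact hd.symm
  · exact hb

theorem exists_singleton (a : M) : ∃ s, IsSet s ∧ ∀ z, z ∈ₘ s ↔ z = a := by
  obtain ⟨s, hs⟩ := h.pairing a a
  exact ⟨s, hs.1, fun z => by simpa using hs.2 z⟩

theorem exists_union (a b : M) : ∃ s, IsSet s ∧ ∀ z, z ∈ₘ s ↔ z ∈ₘ a ∨ z ∈ₘ b := by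
  obtain ⟨t, ht⟩ := h.pairing a b
  obtain ⟨s, hs⟩ := h.union t
  refine ⟨s, hs.1, fun z => (hs.2 z).trans ⟨?_, ?_⟩⟩
  · rintro ⟨w, hw, hz⟩
    rcases (ht.2 w).1 hw with rfl | rfl
    exacts [Or.inl hz, Or.inr hz]
  · rintro (hz | hz)
    exacts [⟨a, (ht.2 a).2 (Or.inl rfl), hz⟩, ⟨b, (ht.2 b).2 (Or.inr rfl), hz⟩]

theorem exists_insert (a b : M) : ∃ s, IsSet s ∧ ∀ z, z ∈ₘ s ↔ z ∈ₘ a ∨ z = b := by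
  obtain ⟨t, ht⟩ := h.exists_singleton b
  obtain ⟨s, hs⟩ := h.exists_union a t
  exact ⟨s, hs.1, fun z => (hs.2 z).trans (or_congr_right (ht.2 z))⟩

theorem exists_succ (x : M) : ∃ y, IsSucc y x := h.exists_insert x x

theorem succ_unique {x y z : M} (hy : IsSucc y x) (hz : IsSucc z x) : y = z :=
  h.ext hy.1 hz.1 fun w => (hy.2 w).trans (hz.2 w).symm

theorem notMem_self (x : M) : ¬ x ∈ₘ x := by
  intro hx
  obtain ⟨s, hs⟩ := h.exists_singleton x
  obtain ⟨y, hy, k⟩ := h.foundation s ⟨x, (hs.2 x).2 rfl⟩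
  obtain rfl := (hs.2 y).1 hy
  exact k y hx hy

/-- The relation between `x` and `y` given by a definable relation. -/
theorem exists_relation (x y : M) (φ : M → M → Prop) (hφ : Def2 φ := by intro _ _ _ _ _; infer_instance) :
    ∃ r, IsRelation r x y ∧ ∀ a b, Rel r a b ↔ a ∈ₘ x ∧ b ∈ₘ y ∧ φ a b := by
  -- Kuratowski pairs of elements of x ∪ y lie in the double power set of x ∪ y.
  obtain ⟨u, hu⟩ := h.exists_union x y
  obtain ⟨p, hp⟩ := h.power u
  obtain ⟨q, hq⟩ := h.power p
  obtain ⟨r, hr⟩ := h.sep q (fun z => ∃ a b, a ∈ₘ x ∧ b ∈ₘ y ∧ φ a b ∧ IsPair z a b)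
  have key : ∀ z, z ∈ₘ r ↔ ∃ a b, a ∈ₘ x ∧ b ∈ₘ y ∧ φ a b ∧ IsPair z a b := by
    intro z
    refine (hr.2 z).trans (and_iff_right_of_imp ?_)
    rintro ⟨a, b, ha, hb, -, hz⟩
    refine (hq.2 z).2 ⟨hz.1, fun s hs => (hp.2 s).2 ?_⟩
    have hau := (hu.2 a).2 (Or.inl ha)
    have hbu := (hu.2 b).2 (Or.inr hb)
    rcases (hz.2 s).1 hs with k | k
    · exact ⟨k.1, fun t ht => by rcases (k.2 t).1 ht with rfl | rfl <;> assumption⟩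
    · exact ⟨k.1, fun t ht => by rcases (k.2 t).1 ht with rfl | rfl <;> assumption⟩
  refine ⟨r, ⟨hr.1, fun z hz => ?_⟩, fun a b => ⟨?_, ?_⟩⟩
  · obtain ⟨a, b, ha, hb, -, k⟩ := (key z).1 hz
    exact ⟨a, b, ha, hb, k⟩
  · rintro ⟨z, hz, k⟩
    obtain ⟨a', b', ha, hb, hf, k'⟩ := (key z).1 hz
    obtain ⟨rfl, rfl⟩ := h.pair_inj k k'
    exact ⟨ha, hb, hf⟩
  · rintro ⟨ha, hb, hf⟩
    obtain ⟨z, hz⟩ := h.exists_pair a b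
    exact ⟨z, (key z).2 ⟨a, b, ha, hb, hf, hz⟩, hz⟩

theorem rel_mem {r x y a b : M} (hr : IsRelation r x y) (k : Rel r a b) : a ∈ₘ x ∧ b ∈ₘ y := by
  obtain ⟨p, hp, hab⟩ := k
  obtain ⟨a', b', ha, hb, k⟩ := hr.2 p hp
  obtain ⟨rfl, rfl⟩ := h.pair_inj hab k
  exact ⟨ha, hb⟩

theorem exists_empty : ∃ e : M, IsEmptySet e := by
  obtain ⟨I, hI, -⟩ := h.infinity
  obtain ⟨e, he, k⟩ := h.sep I (fun _ => False)
  exact ⟨e, he, fun z hz => ((k z).1 hz).2⟩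

theorem empty_unique {x y : M} (hx : IsEmptySet x) (hy : IsEmptySet y) : x = y :=
  h.ext hx.1 hy.1 fun z => iff_of_false (hx.2 z) (hy.2 z)

/-! ### Natural numbers -/

theorem exists_omega : ∃ w : M, IsOmega w := by
  obtain ⟨I, -, hI⟩ := h.infinity
  obtain ⟨w, hw, k⟩ := h.sep I IsNat
  exact ⟨w, hw, fun n => (k n).trans (and_iff_right_of_imp fun hn => hn I hI)⟩

theorem nat_zero {e : M} (he : IsEmptySet e) : IsNat e := by
  rintro I ⟨⟨e', he', k⟩, -⟩
  exact h.empty_unique he' he ▸ k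

theorem nat_succ {n m : M} (hn : IsNat n) (hm : IsSucc m n) : IsNat m := by
  intro I hI
  obtain ⟨y, hy, k⟩ := hI.2 n (hn I hI)
  exact h.succ_unique hy hm ▸ k

/-- The elements of ω with the property form an inductive set. Definability is essential here, since
`M` may have nonstandard natural numbers. -/
theorem nat_induction (φ : M → Prop) (h0 : ∀ e, IsEmptySet e → φ e)
    (hs : ∀ n m, IsNat n → φ n → IsSucc m n → φ m) {n : M} (hn : IsNat n)
    (hφ : Def1 φ := by intro _ _ _; infer_instance) : φ n := by
  obtain ⟨w, hw⟩ := h.exists_omega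
  obtain ⟨I, hI, k⟩ := h.sep w φ
  refine ((k n).1 (hn I ⟨?_, ?_⟩)).2
  · obtain ⟨e, he⟩ := h.exists_empty
    exact ⟨e, he, (k e).2 ⟨(hw.2 e).2 (h.nat_zero he), h0 e he⟩⟩
  · intro x hx
    obtain ⟨hxw, hx⟩ := (k x).1 hx
    obtain ⟨y, hy⟩ := h.exists_succ x
    have hxn := (hw.2 x).1 hxw
    exact ⟨y, hy, (k y).2 ⟨(hw.2 y).2 (h.nat_succ hxn hy), hs x y hxn hx hy⟩⟩

theorem nat_mem {n z : M} (hn : IsNat n) (hz : z ∈ₘ n) : IsNat z :=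
  (h.nat_induction (fun n => ∀ z, z ∈ₘ n → IsNat z) (fun _ he z hz => (he.2 z hz).elim)
    (fun n m hn ih hm z hz => by
      rcases (hm.2 z).1 hz with k | rfl
      exacts [ih z k, hn]) hn) z hz

theorem nat_trans {a b c : M} (hc : IsNat c) (hab : a ∈ₘ b) (hbc : b ∈ₘ c) : a ∈ₘ c :=
  (h.nat_induction (fun c => ∀ a b, a ∈ₘ b → b ∈ₘ c → a ∈ₘ c)
    (fun _ he _ b _ hb => (he.2 b hb).elim)
    (fun n m hn ih hm a b hab hb => (hm.2 a).2 <| Or.inl <| by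
      rcases (hm.2 b).1 hb with k | rfl
      exacts [ih a b hab k, hab]) hc) a b hab hbc

theorem succ_le {n m k : M} (hk : IsSucc k n) (hm : IsNat m) (hnm : n ∈ₘ m) :
    k ∈ₘ m ∨ k = m :=
  (h.nat_induction (fun m => n ∈ₘ m → k ∈ₘ m ∨ k = m)
    (fun _ he hb => (he.2 _ hb).elim)
    (fun m m' hm ih hm' hn => by
      rcases (hm'.2 n).1 hn with hn | rfl
      · exact Or.inl ((hm'.2 k).2 (ih hn))
      · exact Or.inr (h.succ_unique hk hm')) hm) hnm

theorem zero_le {e n : M} (he : IsEmptySet e) (hn : IsNat n) : e ∈ₘ n ∨ e = n :=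
  h.nat_induction (fun n => e ∈ₘ n ∨ e = n) (fun _ he' => Or.inr (h.empty_unique he he'))
    (fun _ _ _ ih hm => Or.inl ((hm.2 e).2 ih)) hn

theorem nat_trichotomy {n m : M} (hn : IsNat n) (hm : IsNat m) : n ∈ₘ m ∨ n = m ∨ m ∈ₘ n :=
  h.nat_induction (fun n => n ∈ₘ m ∨ n = m ∨ m ∈ₘ n)
    (fun e he => (h.zero_le he hm).imp_right Or.inl)
    (fun n k hn ih hk => by
      rcases ih with ih | rfl | ih
      · exact (h.succ_le hk hm ih).imp_right Or.inl
      · exact Or.inr (Or.inr ((hk.2 n).2 (Or.inr rfl)))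
      · exact Or.inr (Or.inr ((hk.2 m).2 (Or.inl ih)))) hn

theorem nat_asymm {n m : M} (hm : IsNat m) (hnm : n ∈ₘ m) : ¬ m ∈ₘ n := fun k =>
  h.notMem_self m (h.nat_trans hm k hnm)

theorem nat_strong_induction (φ : M → Prop) (hs : ∀ n, IsNat n → (∀ m, m ∈ₘ n → φ m) → φ n)
    {n : M} (hn : IsNat n) (hφ : Def1 φ := by intro _ _ _; infer_instance) : φ n := by
  refine hs n hn ?_
  refine h.nat_induction (fun n => ∀ m, m ∈ₘ n → φ m) (fun _ he m hm => (he.2 m hm).elim)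
    (fun n k hn ih hk m hm => ?_) hn
  rcases (hk.2 m).1 hm with hm | rfl
  exacts [ih m hm, hs m hn ih]

theorem nat_max {n m : M} (hn : IsNat n) (hm : IsNat m) :
    ∃ k, IsNat k ∧ n ∈ₘ k ∧ m ∈ₘ k := by
  obtain ⟨n', hn'⟩ := h.exists_succ n
  obtain ⟨m', hm'⟩ := h.exists_succ m
  have hnn := (hn'.2 n).2 (Or.inr rfl)
  have hmm := (hm'.2 m).2 (Or.inr rfl)
  rcases h.nat_trichotomy hn hm with k | rfl | k
  · exact ⟨m', h.nat_succ hm hm', (hm'.2 n).2 (Or.inl k), hmm⟩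
  · exact ⟨n', h.nat_succ hn hn', hnn, hnn⟩
  · exact ⟨n', h.nat_succ hn hn', hnn, (hn'.2 m).2 (Or.inl k)⟩

end IsZFA
end SetStructure

/-! ### Canonical colorings from homogeneous patterns -/

/-- The truth value of `B` on increasing triples is constant. -/
def Hom3 {α : Type*} [LT α] (B : α → α → α → Prop) : Prop :=
  ∀ a b c a' b' c', a < b → b < c → a' < b' → b' < c' → B a b c → B a' b' c'

/-- The truth value of `B` on increasing quadruples is constant. -/
def Hom4 {α : Type*} [LT α] (B : α → α → α → α → Prop) : Prop :=
  ∀ a b c d a' b' c' d', a < b → b < c → c < d → a' < b' → b' < c' → c' < d' →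
    B a b c d → B a' b' c' d'

/-- An equivalence relation `E` between the pairs of a linear order with at least five elements is
canonical if its pattern is the same on all triples and on all pairs of disjoint pairs. -/
theorem canonical_of_hom {α : Type*} [LinearOrder α] (E : α → α → α → α → Prop)
    (refl : ∀ a b, a < b → E a b a b) (symm : ∀ a b c d, E a b c d → E c d a b)
    (trans : ∀ a b c d e f, E a b c d → E c d e f → E a b e f)
    (hl : Hom3 fun a b c => E a b a c) (hr : Hom3 fun a b c => E a c b c)
    (hm : Hom3 fun a b c => E a b b c) (h01 : Hom4 fun a b c d => E a b c d)
    (h02 : Hom4 fun a b c d => E a c b d) (h03 : Hom4 fun a b c d => E a d b c)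
    (five : ∃ a b c d e : α, a < b ∧ b < c ∧ c < d ∧ d < e) :
    (∀ a₁ b₁ a₂ b₂ : α, a₁ < b₁ → a₂ < b₂ → E a₁ b₁ a₂ b₂) ∨
    (∀ a₁ b₁ a₂ b₂ : α, a₁ < b₁ → a₂ < b₂ → (E a₁ b₁ a₂ b₂ ↔ a₁ = a₂)) ∨
    (∀ a₁ b₁ a₂ b₂ : α, a₁ < b₁ → a₂ < b₂ → (E a₁ b₁ a₂ b₂ ↔ b₁ = b₂)) ∨
    (∀ a₁ b₁ a₂ b₂ : α, a₁ < b₁ → a₂ < b₂ → (E a₁ b₁ a₂ b₂ ↔ a₁ = a₂ ∧ b₁ = b₂)) := by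
  obtain ⟨x0, x1, x2, x3, x4, h1, h2, h3, h4⟩ := five
  have left : E x0 x1 x0 x2 → ∀ a b c, a < b → a < c → E a b a c := by
    intro k a b c hab hac
    rcases lt_trichotomy b c with hbc | rfl | hbc
    · exact hl _ _ _ a b c h1 h2 hab hbc k
    · exact refl _ _ hab
    · exact symm _ _ _ _ (hl _ _ _ a c b h1 h2 hac hbc k)
  have right : E x0 x2 x1 x2 → ∀ a b c, a < c → b < c → E a c b c := by
    intro k a b c hac hbc
    rcases lt_trichotomy a b with hab | rfl | hab
    · exact hr _ _ _ a b c h1 h2 hab hbc k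
    · exact refl _ _ hac
    · exact symm _ _ _ _ (hr _ _ _ b a c h1 h2 hab hac k)
  -- If consecutive pairs share a color, then 12 and 13 both have the color of 01, which gives the
  -- left pattern, while 02 and 12 both have the color of 23, which gives the right one.
  have mid : ∀ {a b c}, a < b → b < c → E a b b c → E x0 x1 x0 x2 ∧ E x0 x2 x1 x2 := by
    intro a b c hab hbc k
    have k012 : E x0 x1 x1 x2 := hm _ _ _ _ _ _ hab hbc h1 h2 k
    have k123 : E x1 x2 x2 x3 := hm _ _ _ _ _ _ hab hbc h2 h3 k
    have k013 : E x0 x1 x1 x3 := hm _ _ _ _ _ _ hab hbc h1 (h2.trans h3) k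
    have k023 : E x0 x2 x2 x3 := hm _ _ _ _ _ _ hab hbc (h1.trans h2) h3 k
    have l : E x1 x2 x1 x3 := trans _ _ _ _ _ _ (symm _ _ _ _ k012) k013
    have r : E x0 x2 x1 x2 := trans _ _ _ _ _ _ k023 (symm _ _ _ _ k123)
    exact ⟨hl _ _ _ _ _ _ h2 h3 h1 h2 l, r⟩
  by_cases L : E x0 x1 x0 x2
  · by_cases R : E x0 x2 x1 x2
    -- The two ends are changed one at a time, passing through a pair with the larger of the two
    -- upper ends so that it stays increasing.
    · refine Or.inl fun a b c d hab hcd => ?_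
      have hl' := left L
      have hr' := right R
      rcases le_total b d with hbd | hbd
      · exact trans _ _ _ _ _ _ (hl' a b d hab (hab.trans_le hbd))
          (hr' a c d (hab.trans_le hbd) hcd)
      · exact trans _ _ _ _ _ _ (hr' a c b hab (hcd.trans_le hbd))
          (hl' c b d (hcd.trans_le hbd) hcd)
    · refine Or.inr (Or.inl fun a b c d hab hcd => ⟨fun k => ?_, ?_⟩)
      · by_contra hac
        wlog hlt : a < c generalizing a b c d with W
        · exact W c d a b hcd hab (symm _ _ _ _ k) (Ne.symm hac)
            (lt_of_le_of_ne (not_lt.1 hlt) (Ne.symm hac))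
        -- The pair ac has the color of ab, hence that of cd. These are consecutive pairs, so the
        -- right pattern would hold as well.
        have := trans _ _ _ _ _ _ (left L a c b hlt hab) k
        exact R (mid hlt hcd this).2
      · rintro rfl
        exact left L _ _ _ hab hcd
  · by_cases R : E x0 x2 x1 x2
    · refine Or.inr (Or.inr (Or.inl fun a b c d hab hcd => ⟨fun k => ?_, ?_⟩))
      · by_contra hbd
        wlog hlt : b < d generalizing a b c d with W
        · exact W c d a b hcd hab (symm _ _ _ _ k) (Ne.symm hbd)
            (lt_of_le_of_ne (not_lt.1 hlt) (Ne.symm hbd))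
        have := trans _ _ _ _ _ _ k (right R c b d hcd hlt)
        exact L (mid hab hlt this).1
      · rintro rfl
        exact right R _ _ _ hab hcd
    · refine Or.inr (Or.inr (Or.inr fun a b c d hab hcd => ⟨fun k => ?_, ?_⟩))
      · have nl : ∀ a b c, a < b → a < c → b ≠ c → ¬ E a b a c := by
          intro a b c hab hac hbc k
          rcases lt_or_gt_of_ne hbc with hbc | hbc
          · exact L (hl _ _ _ _ _ _ hab hbc h1 h2 k)
          · exact L (hl _ _ _ _ _ _ hac hbc h1 h2 (symm _ _ _ _ k))
        have nr : ∀ a b c, a < c → b < c → a ≠ b → ¬ E a c b c := by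
          intro a b c hac hbc hab k
          rcases lt_or_gt_of_ne hab with hab | hab
          · exact R (hr _ _ _ _ _ _ hab hbc h1 h2 k)
          · exact R (hr _ _ _ _ _ _ hab hac h1 h2 (symm _ _ _ _ k))
        have nm : ∀ a b c, a < b → b < c → ¬ E a b b c := fun a b c hab hbc k =>
          L (mid hab hbc k).1
        by_contra hne
        wlog hlt : a < c ∨ a = c ∧ b < d generalizing a b c d with W
        · refine W c d a b hcd hab (symm _ _ _ _ k) (fun e => hne ⟨e.1.symm, e.2.symm⟩) ?_
          rw [not_or, not_lt, not_and, not_lt] at hlt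
          rcases hlt.1.lt_or_eq with e | e
          · exact Or.inl e
          · exact Or.inr ⟨e, lt_of_le_of_ne (hlt.2 e.symm) fun e' => hne ⟨e.symm, e'.symm⟩⟩
        rcases hlt with hlt | ⟨rfl, hlt⟩
        · rcases lt_trichotomy b c with hbc | rfl | hbc
          -- In each of the three disjoint patterns an upper end can be moved from x3 to x4 without
          -- changing the color of the other pair. This yields two equally colored pairs with the
          -- same lower end, against the failure of the left pattern. The fifth point is needed
          -- here.
          · have k1 : E x0 x1 x2 x3 := h01 _ _ _ _ _ _ _ _ hab hbc hcd h1 h2 h3 k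
            have k2 : E x0 x1 x2 x4 := h01 _ _ _ _ _ _ _ _ hab hbc hcd h1 h2 (h3.trans h4) k
            exact nl _ _ _ h3 (h3.trans h4) h4.ne
              (trans _ _ _ _ _ _ (symm _ _ _ _ k1) k2)
          · exact nm _ _ _ hab hcd k
          · rcases lt_trichotomy b d with hbd | rfl | hbd
            · have k1 : E x0 x2 x1 x3 := h02 _ _ _ _ _ _ _ _ hlt hbc hbd h1 h2 h3 k
              have k2 : E x0 x2 x1 x4 := h02 _ _ _ _ _ _ _ _ hlt hbc hbd h1 h2 (h3.trans h4) k
              exact nl _ _ _ (h2.trans h3) ((h2.trans h3).trans h4) h4.ne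
                (trans _ _ _ _ _ _ (symm _ _ _ _ k1) k2)
            · exact nr _ _ _ hab hcd hlt.ne k
            · have k1 : E x0 x3 x1 x2 := h03 _ _ _ _ _ _ _ _ hlt hcd hbd h1 h2 h3 k
              have k2 : E x0 x4 x1 x2 := h03 _ _ _ _ _ _ _ _ hlt hcd hbd h1 h2 (h3.trans h4) k
              exact nl _ _ _ ((h1.trans h2).trans h3) (((h1.trans h2).trans h3).trans h4) h4.ne
                (trans _ _ _ _ _ _ k1 (symm _ _ _ _ k2))
        · exact nl _ _ _ hab hcd hlt.ne k
      · rintro ⟨rfl, rfl⟩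
        exact refl _ _ hab

/-! ### Ramsey's theorem for quadruples of natural numbers, without choice -/

namespace SetStructure

section
variable {M : Type u} [SetStructure M]

/-- `X` is an unbounded set of natural numbers. -/
def IsUnbounded (X : M) : Prop :=
  (∀ x, x ∈ₘ X → IsNat x) ∧ ∀ n, IsNat n → ∃ x, x ∈ₘ X ∧ n ∈ₘ x

instance {n : ℕ} (a : (Fin n → M) → M) [Tm a] : D (fun w => IsUnbounded (a w)) := by
  unfold IsUnbounded; infer_instance

/-- The truth value of `φ` on increasing quadruples from `Y` is constant. -/
def HomOn (lt : M → M → Prop) (Y : M) (φ : M → M → M → M → Prop) : Prop :=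
  ∀ a b c d a' b' c' d', a ∈ₘ Y → b ∈ₘ Y → c ∈ₘ Y → d ∈ₘ Y → a' ∈ₘ Y → b' ∈ₘ Y → c' ∈ₘ Y →
    d' ∈ₘ Y → lt a b → lt b c → lt c d → lt a' b' → lt b' c' → lt c' d' →
    φ a b c d → φ a' b' c' d'

theorem HomOn.mono {lt : M → M → Prop} {Y Z : M} {φ : M → M → M → M → Prop} (k : HomOn lt Y φ)
    (hZ : Sub Z Y) : HomOn lt Z φ := fun a b c d a' b' c' d' ha hb hc hd ha' hb' hc' hd' =>
  k a b c d a' b' c' d' (hZ a ha) (hZ b hb) (hZ c hc) (hZ d hd) (hZ a' ha') (hZ b' hb')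
    (hZ c' hc') (hZ d' hd')

/-- The pattern of the equivalence relation `E` between pairs is constant on `Y`. -/
structure PatternOn (lt : M → M → Prop) (Y : M) (E : M → M → M → M → Prop) : Prop where
  left : HomOn lt Y fun a b c _ => E a b a c
  right : HomOn lt Y fun a b c _ => E a c b c
  mid : HomOn lt Y fun a b c _ => E a b b c
  disj : HomOn lt Y fun a b c d => E a b c d
  cross : HomOn lt Y fun a b c d => E a c b d
  nest : HomOn lt Y fun a b c d => E a d b c

theorem PatternOn.mono {lt : M → M → Prop} {Y Z : M} {E : M → M → M → M → Prop}
    (k : PatternOn lt Y E) (hZ : Sub Z Y) : PatternOn lt Z E :=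
  ⟨k.left.mono hZ, k.right.mono hZ, k.mid.mono hZ, k.disj.mono hZ, k.cross.mono hZ,
    k.nest.mono hZ⟩

/-- Homogeneity passes to subsets, so the patterns can be stabilized one after the other with a
two-valued Ramsey theorem; three-point patterns ignore the last argument. The notion `Large` is left
abstract in order to serve both unbounded sets of natural numbers and infinite subsets of an ordered
set. -/
theorem exists_patternOn (Large : M → Prop) (lt : M → M → Prop)
    (step : ∀ φ, Def4 φ → ∀ X : M, Large X → ∃ Y, Large Y ∧ Sub Y X ∧ HomOn lt Y φ)
    (E : M → M → M → M → Prop) (hE : Def4 E) {X : M} (hX : Large X) :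
    ∃ Y, Large Y ∧ Sub Y X ∧ PatternOn lt Y E := by
  obtain ⟨Y1, l1, s1, k1⟩ := step (fun a b c _ => E a b a c)
    (by intro _ _ _ _ _ _ _ _ _; infer_instance) X hX
  obtain ⟨Y2, l2, s2, k2⟩ := step (fun a b c _ => E a c b c)
    (by intro _ _ _ _ _ _ _ _ _; infer_instance) Y1 l1
  obtain ⟨Y3, l3, s3, k3⟩ := step (fun a b c _ => E a b b c)
    (by intro _ _ _ _ _ _ _ _ _; infer_instance) Y2 l2
  obtain ⟨Y4, l4, s4, k4⟩ := step (fun a b c d => E a b c d)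
    (by intro _ _ _ _ _ _ _ _ _; infer_instance) Y3 l3
  obtain ⟨Y5, l5, s5, k5⟩ := step (fun a b c d => E a c b d)
    (by intro _ _ _ _ _ _ _ _ _; infer_instance) Y4 l4
  obtain ⟨Y6, l6, s6, k6⟩ := step (fun a b c d => E a d b c)
    (by intro _ _ _ _ _ _ _ _ _; infer_instance) Y5 l5
  have t5 : Sub Y6 Y4 := fun z hz => s5 z (s6 z hz)
  have t4 : Sub Y6 Y3 := fun z hz => s4 z (t5 z hz)
  have t3 : Sub Y6 Y2 := fun z hz => s3 z (t4 z hz)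
  have t2 : Sub Y6 Y1 := fun z hz => s2 z (t3 z hz)
  exact ⟨Y6, l6, fun z hz => s1 z (t2 z hz), k1.mono t2, k2.mono t3, k3.mono t4, k4.mono t5,
    k5.mono s6, k6⟩

end

namespace IsZFA
variable {M : Type u} [SetStructure M] (h : IsZFA M)
include h

/-- A set of natural numbers can be defined by recursion: whether `i` belongs to it may depend on
the smaller elements. -/
theorem exists_recursive_set (Φ : M → M → Prop) (hΦ : Def2 Φ) :
    ∃ T : M, (∀ i, i ∈ₘ T → IsNat i) ∧
      ∀ i t, IsNat i → IsSet t → (∀ z, z ∈ₘ t ↔ z ∈ₘ T ∧ z ∈ₘ i) → (i ∈ₘ T ↔ Φ i t) := by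
  -- `Good n t` says that t is the part below n of the set to be built. Such approximations agree
  -- where they overlap (`coh`) and exist for every n (`ex`).
  let Good : M → M → Prop := fun n t => IsSet t ∧ (∀ z, z ∈ₘ t → z ∈ₘ n) ∧
    ∀ i, i ∈ₘ n → ∀ s, IsSet s → (∀ z, z ∈ₘ s ↔ z ∈ₘ t ∧ z ∈ₘ i) → (i ∈ₘ t ↔ Φ i s)
  have hGood : Def2 Good := by intro _ _ _ _ _; infer_instance
  have coh : ∀ {n m t t' : M}, IsNat n → IsNat m → Good n t → Good m t' → ∀ i, i ∈ₘ n → i ∈ₘ m →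
      (i ∈ₘ t ↔ i ∈ₘ t') := by
    intro n m t t' hn hm ht ht' i hi hi'
    refine (h.nat_strong_induction (fun i => i ∈ₘ n → i ∈ₘ m → (i ∈ₘ t ↔ i ∈ₘ t'))
      (fun i _ ih hi hi' => ?_) (h.nat_mem hn hi)) hi hi'
    obtain ⟨s, hs, k⟩ := h.sep t (fun z => z ∈ₘ i)
    refine (ht.2.2 i hi s hs k).trans (ht'.2.2 i hi' s hs fun z => (k z).trans ?_).symm
    refine and_congr_left fun hz => ih z hz (h.nat_trans hn hz hi) (h.nat_trans hm hz hi')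
  have ex : ∀ {n : M}, IsNat n → ∃ t, Good n t := by
    intro n hn
    refine h.nat_induction (fun n => ∃ t, Good n t) (fun e he => ⟨e, he.1, fun _ hz => hz,
      fun i hi => (he.2 i hi).elim⟩) (fun n m hn ih hm => ?_) hn
    obtain ⟨t, ht⟩ := ih
    have hlt : ∀ {t'}, (∀ z, z ∈ₘ n → (z ∈ₘ t' ↔ z ∈ₘ t)) → ∀ i, i ∈ₘ n → ∀ s, IsSet s →
        (∀ z, z ∈ₘ s ↔ z ∈ₘ t' ∧ z ∈ₘ i) → (i ∈ₘ t' ↔ Φ i s) := by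
      intro t' e i hi s hs k
      refine (e i hi).trans (ht.2.2 i hi s hs fun z => (k z).trans ?_)
      exact and_congr_left fun hz => e z (h.nat_trans hn hz hi)
    have hn' : ¬ n ∈ₘ t := fun k => h.notMem_self n (ht.2.1 n k)
    by_cases hc : Φ n t
    · obtain ⟨t', hs', k'⟩ := h.exists_insert t n
      have e : ∀ z, z ∈ₘ n → (z ∈ₘ t' ↔ z ∈ₘ t) := fun z hz => (k' z).trans
        (or_iff_left fun e => h.notMem_self n (e ▸ hz))
      refine ⟨t', hs', fun z hz => (hm.2 z).2 (((k' z).1 hz).imp_left (ht.2.1 z)), ?_⟩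
      intro i hi s hs k
      rcases (hm.2 i).1 hi with hi | rfl
      · exact hlt e i hi s hs k
      · have : s = t := h.ext hs ht.1 fun z => (k z).trans
          ⟨fun hz => (e z hz.2).1 hz.1, fun hz => ⟨(k' z).2 (Or.inl hz), ht.2.1 z hz⟩⟩
        exact iff_of_true ((k' i).2 (Or.inr rfl)) (this ▸ hc)
    · refine ⟨t, ht.1, fun z hz => (hm.2 z).2 (Or.inl (ht.2.1 z hz)), ?_⟩
      intro i hi s hs k
      rcases (hm.2 i).1 hi with hi | rfl
      · exact hlt (fun _ _ => Iff.rfl) i hi s hs k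
      · have : s = t := h.ext hs ht.1 fun z => (k z).trans
          ⟨fun hz => hz.1, fun hz => ⟨hz, ht.2.1 z hz⟩⟩
        exact iff_of_false hn' (this ▸ hc)
  obtain ⟨w, hw⟩ := h.exists_omega
  obtain ⟨T, -, hT⟩ := h.sep w (fun i => ∃ n t, i ∈ₘ n ∧ IsNat n ∧ Good n t ∧ i ∈ₘ t)
  refine ⟨T, fun i hi => (hw.2 i).1 ((hT i).1 hi).1, fun i s hi hs k => ?_⟩
  obtain ⟨m, hm⟩ := h.exists_succ i
  have hmn := h.nat_succ hi hm
  obtain ⟨t, ht⟩ := ex hmn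
  have key : ∀ j, j ∈ₘ m → (j ∈ₘ T ↔ j ∈ₘ t) := by
    intro j hj
    refine (hT j).trans ⟨?_, fun hj' => ⟨(hw.2 j).2 (h.nat_mem hmn hj), m, t, hj, hmn, ht, hj'⟩⟩
    rintro ⟨-, n, t', hjn, hn, ht', hj'⟩
    exact (coh hn hmn ht' ht j hjn hj).1 hj'
  have him : i ∈ₘ m := (hm.2 i).2 (Or.inr rfl)
  refine (key i him).trans (ht.2.2 i him s hs fun z => (k z).trans ?_)
  exact and_congr_left fun hz => key z ((hm.2 z).2 (Or.inl hz))

/-- If an unbounded set is split into two, one of the parts is unbounded. -/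
theorem unbounded_split {X : M} (hX : IsUnbounded X) (φ : M → Prop) :
    (∀ n, IsNat n → ∃ x, x ∈ₘ X ∧ φ x ∧ n ∈ₘ x) ∨
      ∀ n, IsNat n → ∃ x, x ∈ₘ X ∧ ¬ φ x ∧ n ∈ₘ x := by
  by_contra! hc
  obtain ⟨⟨n, hn, k⟩, m, hm, k'⟩ := hc
  obtain ⟨l, hl, hnl, hml⟩ := h.nat_max hn hm
  obtain ⟨x, hx, hlx⟩ := hX.2 l hl
  have hxn := hX.1 x hx
  by_cases hφ : φ x
  · exact k x hx hφ (h.nat_trans hxn hnl hlx)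
  · exact k' x hx hφ (h.nat_trans hxn hml hlx)

/-- A partition of the natural numbers into two pieces meets every unbounded set in an unbounded
piece. -/
theorem unbounded_class_of_prop {X : M} (hX : IsUnbounded X) (φ : M → Prop) :
    ∃ t, t ∈ₘ X ∧ ∀ n, IsNat n → ∃ x, x ∈ₘ X ∧ (φ x ↔ φ t) ∧ n ∈ₘ x := by
  obtain ⟨e, he⟩ := h.exists_empty
  rcases h.unbounded_split hX φ with k | k
  · obtain ⟨t, ht, hφ, -⟩ := k e (h.nat_zero he)
    refine ⟨t, ht, fun n hn => ?_⟩
    obtain ⟨x, hx, hφ', hnx⟩ := k n hn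
    exact ⟨x, hx, iff_of_true hφ' hφ, hnx⟩
  · obtain ⟨t, ht, hφ, -⟩ := k e (h.nat_zero he)
    refine ⟨t, ht, fun n hn => ?_⟩
    obtain ⟨x, hx, hφ', hnx⟩ := k n hn
    exact ⟨x, hx, iff_of_false hφ' hφ, hnx⟩

/-- The common refinement of finitely many equivalence relations, each of which has an unbounded
class on every unbounded set, again has an unbounded class on every unbounded set. -/
theorem unbounded_class_of_forall (G : M → M → M → Prop) (hG : Def3 G)
    (symm : ∀ a x y, G a x y → G a y x) (trans : ∀ a x y z, G a x y → G a y z → G a x z)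
    (hf : ∀ a X, IsUnbounded X → ∃ t, t ∈ₘ X ∧ ∀ n, IsNat n → ∃ x, x ∈ₘ X ∧ G a x t ∧ n ∈ₘ x)
    {m X : M} (hm : IsNat m) (hX : IsUnbounded X) :
    ∃ t, t ∈ₘ X ∧ ∀ n, IsNat n → ∃ x, x ∈ₘ X ∧ (∀ a, a ∈ₘ m → G a x t) ∧ n ∈ₘ x := by
  refine h.nat_induction
    (fun m => ∃ t, t ∈ₘ X ∧ ∀ n, IsNat n → ∃ x, x ∈ₘ X ∧ (∀ a, a ∈ₘ m → G a x t) ∧ n ∈ₘ x)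
    (fun e he => ?_) (fun m k _ ih hk => ?_) hm
  · obtain ⟨t, ht, -⟩ := hX.2 e (h.nat_zero he)
    refine ⟨t, ht, fun n hn => ?_⟩
    obtain ⟨x, hx, hnx⟩ := hX.2 n hn
    exact ⟨x, hx, fun a ha => (he.2 a ha).elim, hnx⟩
  · obtain ⟨t, ht, ih⟩ := ih
    obtain ⟨X', -, hX'⟩ := h.sep X (fun x => ∀ a, a ∈ₘ m → G a x t)
    have inf : IsUnbounded X' := by
      refine ⟨fun x hx => hX.1 x ((hX' x).1 hx).1, fun n hn => ?_⟩
      obtain ⟨x, hx, hG, hnx⟩ := ih n hn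
      exact ⟨x, (hX' x).2 ⟨hx, hG⟩, hnx⟩
    obtain ⟨t', ht', k'⟩ := hf m X' inf
    refine ⟨t', ((hX' t').1 ht').1, fun n hn => ?_⟩
    obtain ⟨x, hx, hG, hnx⟩ := k' n hn
    refine ⟨x, ((hX' x).1 hx).1, fun a ha => ?_, hnx⟩
    rcases (hk.2 a).1 ha with ha | rfl
    · exact trans _ _ _ _ (((hX' x).1 hx).2 a ha) (symm _ _ _ (((hX' t').1 ht').2 a ha))
    · exact hG

/-- The pigeonhole principle for the type of x over all triples of parameters below m, obtained by
nesting the refinement lemma once for each of the three parameters. -/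
theorem unbounded_class_of_forall₃ (φ : M → M → M → M → Prop) (hφ : Def4 φ)
    {m X : M} (hm : IsNat m) (hX : IsUnbounded X) :
    ∃ t, t ∈ₘ X ∧ ∀ n, IsNat n → ∃ x, x ∈ₘ X ∧
      (∀ a, a ∈ₘ m → ∀ b, b ∈ₘ m → ∀ c, c ∈ₘ m → (φ a b c x ↔ φ a b c t)) ∧ n ∈ₘ x := by
  refine h.unbounded_class_of_forall
    (fun a x t => ∀ b, b ∈ₘ m → ∀ c, c ∈ₘ m → (φ a b c x ↔ φ a b c t))
    (by intro _ _ _ _ _ _ _; infer_instance) (fun a x y k b hb c hc => (k b hb c hc).symm)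
    (fun a x y z k k' b hb c hc => (k b hb c hc).trans (k' b hb c hc)) (fun a X hX => ?_) hm hX
  refine h.unbounded_class_of_forall
    (fun b x t => ∀ c, c ∈ₘ m → (φ a b c x ↔ φ a b c t))
    (by intro _ _ _ _ _ _ _; infer_instance) (fun a x y k c hc => (k c hc).symm)
    (fun a x y z k k' c hc => (k c hc).trans (k' c hc)) (fun b X hX => ?_) hm hX
  refine h.unbounded_class_of_forall (fun c x t => (φ a b c x ↔ φ a b c t))
    (by intro _ _ _ _ _ _ _; infer_instance) (fun a x y k => k.symm)
    (fun a x y z k k' => k.trans k') (fun c X hX => ?_) hm hX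
  exact h.unbounded_class_of_prop hX fun x => φ a b c x

theorem exists_max_of_bounded {Y y : M} (hy : y ∈ₘ Y) {n : M} (hn : IsNat n) (hyn : y ∈ₘ n) :
    ∃ m, m ∈ₘ Y ∧ m ∈ₘ n ∧ ∀ z, z ∈ₘ Y → z ∈ₘ n → z ∈ₘ m ∨ z = m := by
  refine (h.nat_induction (fun n => (∃ y, y ∈ₘ Y ∧ y ∈ₘ n) →
    ∃ m, m ∈ₘ Y ∧ m ∈ₘ n ∧ ∀ z, z ∈ₘ Y → z ∈ₘ n → z ∈ₘ m ∨ z = m)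
    (fun e he ⟨y, _, hy⟩ => (he.2 y hy).elim) (fun n m _ ih hm => ?_) hn) ⟨y, hy, hyn⟩
  rintro ⟨y, hy, hym⟩
  by_cases hnY : n ∈ₘ Y
  · exact ⟨n, hnY, (hm.2 n).2 (Or.inr rfl), fun z _ hz => (hm.2 z).1 hz⟩
  · have hlt : ∀ z, z ∈ₘ Y → z ∈ₘ m → z ∈ₘ n := fun z hz hzm =>
      ((hm.2 z).1 hzm).resolve_right fun e => hnY (e ▸ hz)
    obtain ⟨k, hk, hkn, hmax⟩ := ih ⟨y, hy, hlt y hy hym⟩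
    exact ⟨k, hk, (hm.2 k).2 (Or.inl hkn), fun z hz hzm => hmax z hz (hlt z hz hzm)⟩

/-- An unbounded set can be thinned out so that `φ` does not depend on its last argument, as long as
this is greater than the others. -/
theorem exists_endHomogeneous (φ : M → M → M → M → Prop) (hφ : Def4 φ) {X : M}
    (hX : IsUnbounded X) :
    ∃ Y, IsUnbounded Y ∧ Sub Y X ∧ ∀ a b c x x', a ∈ₘ Y → b ∈ₘ Y → c ∈ₘ Y → x ∈ₘ Y → x' ∈ₘ Y →
      a ∈ₘ x → b ∈ₘ x → c ∈ₘ x → a ∈ₘ x' → b ∈ₘ x' → c ∈ₘ x' →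
        (φ a b c x ↔ φ a b c x') := by
  -- `E z x y`: the last arguments x and y are indistinguishable for `φ` over parameters up to z.
  let E : M → M → M → Prop := fun z x y => ∀ a b c, (a ∈ₘ z ∨ a = z) → (b ∈ₘ z ∨ b = z) →
    (c ∈ₘ z ∨ c = z) → (φ a b c x ↔ φ a b c y)
  have hE : Def3 E := by intro _ _ _ _ _ _ _; infer_instance
  -- Here p is the part of Y below y. The element y is admitted if it agrees with each earlier y'
  -- over every z in p below y', and if unboundedly many x in X agree in this way with all of p and
  -- with y. The last clause keeps the construction from stopping.
  let Φ : M → M → Prop := fun y p => y ∈ₘ X ∧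
    (∀ z y', z ∈ₘ p → y' ∈ₘ p → z ∈ₘ y' → E z y y') ∧
    ∀ n, IsNat n → ∃ x, x ∈ₘ X ∧ n ∈ₘ x ∧
      ∀ z y', z ∈ₘ p → (y' ∈ₘ p ∨ y' = y) → z ∈ₘ y' → E z x y'
  have hΦ : Def2 Φ := by intro _ _ _ _ _; infer_instance
  obtain ⟨Y, hYn, hY⟩ := h.exists_recursive_set Φ hΦ
  have spec : ∀ y, y ∈ₘ Y → ∃ p, (∀ z, z ∈ₘ p ↔ z ∈ₘ Y ∧ z ∈ₘ y) ∧ Φ y p := by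
    intro y hy
    obtain ⟨p, hp, k⟩ := h.sep Y (fun z => z ∈ₘ y)
    exact ⟨p, k, (hY y p (hYn y hy) hp k).1 hy⟩
  have unb : IsUnbounded Y := by
    refine ⟨hYn, ?_⟩
    by_contra! hc
    obtain ⟨n, hn, hc⟩ := hc
    obtain ⟨n', hn'⟩ := h.exists_succ n
    have hnn' := h.nat_succ hn hn'
    have hle : ∀ y, y ∈ₘ Y → y ∈ₘ n ∨ y = n := fun y hy => by
      rcases h.nat_trichotomy (hYn y hy) hn with k | k | k
      exacts [Or.inl k, Or.inr k, (hc y hy k).elim]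
    -- If Y were bounded, its greatest element would have been admitted with unboundedly many
    -- candidates x agreeing with all of Y. If Y is empty there is nothing to agree with.
    have hSinf : ∀ n, IsNat n → ∃ x, x ∈ₘ X ∧ n ∈ₘ x ∧
        ∀ z y', z ∈ₘ Y → y' ∈ₘ Y → z ∈ₘ y' → E z x y' := by
      by_cases hne : ∃ y, y ∈ₘ Y
      · obtain ⟨y, hy⟩ := hne
        obtain ⟨m, hm, -, hmax⟩ := h.exists_max_of_bounded hy hnn' ((hn'.2 y).2 (hle y hy))
        obtain ⟨p, hp, -, -, k⟩ := spec m hm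
        intro l hl
        obtain ⟨x, hx, hlx, k⟩ := k l hl
        refine ⟨x, hx, hlx, fun z y' hz hy' hzy' => ?_⟩
        have hy'm := hmax y' hy' ((hn'.2 y').2 (hle y' hy'))
        have hzm : z ∈ₘ m := by
          rcases hy'm with k | rfl
          exacts [h.nat_trans (hYn m hm) hzy' k, hzy']
        exact k z y' ((hp z).2 ⟨hz, hzm⟩) (hy'm.imp_left fun k => (hp y').2 ⟨hy', k⟩) hzy'
      · intro l hl
        obtain ⟨x, hx, hlx⟩ := hX.2 l hl
        exact ⟨x, hx, hlx, fun z _ hz => (hne ⟨z, hz⟩).elim⟩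
    obtain ⟨S, -, hS⟩ := h.sep X (fun x => n ∈ₘ x ∧
      ∀ z y', z ∈ₘ Y → y' ∈ₘ Y → z ∈ₘ y' → E z x y')
    have hSu : IsUnbounded S := by
      refine ⟨fun x hx => hX.1 x ((hS x).1 hx).1, fun l hl => ?_⟩
      obtain ⟨l', hl', hll', hnl'⟩ := h.nat_max hl hn
      obtain ⟨x, hx, hlx, k⟩ := hSinf l' hl'
      have hxn := hX.1 x hx
      exact ⟨x, (hS x).2 ⟨hx, h.nat_trans hxn hnl' hlx, k⟩, h.nat_trans hxn hll' hlx⟩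
    -- Among the candidates, some t has its type over n + 1 shared by unboundedly many others. It
    -- meets the condition for admission although it lies beyond the supposed bound n.
    obtain ⟨t, ht, k⟩ := h.unbounded_class_of_forall₃ φ hφ hnn' hSu
    obtain ⟨htX, hnt, htE⟩ := (hS t).1 ht
    have htn := hX.1 t htX
    have hYt : ∀ y, y ∈ₘ Y → y ∈ₘ t := fun y hy => by
      rcases hle y hy with k | rfl
      exacts [h.nat_trans htn k hnt, hnt]
    obtain ⟨Y', hY's, hY'⟩ := h.sep Y (fun _ => True)
    refine hc t ((hY t Y' htn hY's fun z => (hY' z).trans ⟨fun k => ⟨k.1, hYt z k.1⟩,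
      fun k => ⟨k.1, trivial⟩⟩).2 ⟨htX, fun z y' hz hy' => htE z y' ((hY' z).1 hz).1
        ((hY' y').1 hy').1, fun l hl => ?_⟩) hnt
    obtain ⟨x, hx, hxE, hlx⟩ := k l hl
    obtain ⟨hxX, -, hxE'⟩ := (hS x).1 hx
    refine ⟨x, hxX, hlx, fun z y' hz hy' hzy' => ?_⟩
    have hzY := ((hY' z).1 hz).1
    rcases hy' with hy' | rfl
    · exact hxE' z y' hzY ((hY' y').1 hy').1 hzy'
    · have hle' : ∀ a, (a ∈ₘ z ∨ a = z) → a ∈ₘ n' := by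
        intro a ha
        have hz' := (hn'.2 z).2 (hle z hzY)
        rcases ha with ha | rfl
        exacts [h.nat_trans hnn' ha hz', hz']
      exact fun a b c ha hb hc => hxE a (hle' a ha) b (hle' b hb) c (hle' c hc)
  refine ⟨Y, unb, fun y hy => ?_, ?_⟩
  · obtain ⟨p, -, k, -⟩ := spec y hy
    exact k
  · intro a b c x x' ha hb hc hx hx' hax hbx hcx hax' hbx' hcx'
    -- The larger of x and x' was admitted only because it agrees with the smaller one over every
    -- earlier z. It remains to take for z the greatest of a, b, c.
    have main : ∀ z x x', z ∈ₘ Y → x ∈ₘ Y → x' ∈ₘ Y → z ∈ₘ x → z ∈ₘ x' → E z x x' := by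
      intro z x x' hz hx hx' hzx hzx'
      rcases h.nat_trichotomy (hYn x hx) (hYn x' hx') with k | rfl | k
      · obtain ⟨p, hp, -, e, -⟩ := spec x' hx'
        have := e z x ((hp z).2 ⟨hz, hzx'⟩) ((hp x).2 ⟨hx, k⟩) hzx
        exact fun a b c ha hb hc => (this a b c ha hb hc).symm
      · exact fun a b c ha hb hc => Iff.rfl
      · obtain ⟨p, hp, -, e, -⟩ := spec x hx
        exact e z x' ((hp z).2 ⟨hz, hzx⟩) ((hp x').2 ⟨hx', k⟩) hzx'
    have max2 : ∀ a b : M, IsNat a → IsNat b → ((b ∈ₘ a ∨ b = a) ∨ (a ∈ₘ b ∨ a = b)) := by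
      intro a b ha hb
      rcases h.nat_trichotomy ha hb with k | k | k
      exacts [Or.inr (Or.inl k), Or.inr (Or.inr k), Or.inl (Or.inl k)]
    have le_trans' : ∀ a b c : M, IsNat c → (a ∈ₘ b ∨ a = b) → (b ∈ₘ c ∨ b = c) →
        (a ∈ₘ c ∨ a = c) := by
      rintro a b c hc (k | rfl) (k' | rfl)
      exacts [Or.inl (h.nat_trans hc k k'), Or.inl k, Or.inl k', Or.inr rfl]
    have na := hYn a ha
    have nb := hYn b hb
    have nc := hYn c hc
    rcases max2 a b na nb with hba | hab
    · rcases max2 a c na nc with hca | hac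
      · exact main a x x' ha hx hx' hax hax' a b c (Or.inr rfl) hba hca
      · exact main c x x' hc hx hx' hcx hcx' a b c hac (le_trans' _ _ _ nc hba hac) (Or.inr rfl)
    · rcases max2 b c nb nc with hcb | hbc
      · exact main b x x' hb hx hx' hbx hbx' a b c hab (Or.inr rfl) hcb
      · exact main c x x' hc hx hx' hcx hcx' a b c (le_trans' _ _ _ nc hab hbc) hbc (Or.inr rfl)

/-- Ramsey's theorem for quadruples of natural numbers and two colors. -/
theorem exists_homOn_unbounded (φ : M → M → M → M → Prop) (hφ : Def4 φ) {X : M}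
    (hX : IsUnbounded X) : ∃ Y : M, IsUnbounded Y ∧ Sub Y X ∧ HomOn mem Y φ := by
  obtain ⟨Y1, u1, s1, k1⟩ := h.exists_endHomogeneous φ hφ hX
  -- On Y1 the value of `φ` no longer depends on d, so d is quantified away and the same is done for
  -- c, then for b. Dummy arguments put the variable to be eliminated in the last place.
  obtain ⟨Y2, u2, s2, k2⟩ := h.exists_endHomogeneous
    (fun a b (_ c : M) => ∃ d, d ∈ₘ Y1 ∧ a ∈ₘ d ∧ b ∈ₘ d ∧ c ∈ₘ d ∧ φ a b c d)
    (by intro _ _ _ _ _ _ _ _ _; infer_instance) u1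
  obtain ⟨Y3, u3, s3, k3⟩ := h.exists_endHomogeneous
    (fun (a _ _ b : M) => ∃ c, c ∈ₘ Y2 ∧ a ∈ₘ c ∧ b ∈ₘ c ∧
      ∃ d, d ∈ₘ Y1 ∧ a ∈ₘ d ∧ b ∈ₘ d ∧ c ∈ₘ d ∧ φ a b c d)
    (by intro _ _ _ _ _ _ _ _ _; infer_instance) u2
  have hD : Def1 fun a : M => ∃ b, b ∈ₘ Y3 ∧ a ∈ₘ b ∧ ∃ c, c ∈ₘ Y2 ∧ a ∈ₘ c ∧ b ∈ₘ c ∧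
      ∃ d, d ∈ₘ Y1 ∧ a ∈ₘ d ∧ b ∈ₘ d ∧ c ∈ₘ d ∧ φ a b c d := by
    intro _ _ _; infer_instance
  have key : ∀ a b c d, a ∈ₘ Y3 → b ∈ₘ Y3 → c ∈ₘ Y3 → d ∈ₘ Y3 → a ∈ₘ b → b ∈ₘ c → c ∈ₘ d →
      (φ a b c d ↔ ∃ b, b ∈ₘ Y3 ∧ a ∈ₘ b ∧ ∃ c, c ∈ₘ Y2 ∧ a ∈ₘ c ∧ b ∈ₘ c ∧
      ∃ d, d ∈ₘ Y1 ∧ a ∈ₘ d ∧ b ∈ₘ d ∧ c ∈ₘ d ∧ φ a b c d) := by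
    intro a b c d ha hb hc hd hab hbc hcd
    have nc := u3.1 c hc
    have nd := u3.1 d hd
    have hac := h.nat_trans nc hab hbc
    have had := h.nat_trans nd hac hcd
    have hbd := h.nat_trans nd hbc hcd
    have e3 : ∀ {a b c d}, a ∈ₘ Y2 → b ∈ₘ Y2 → c ∈ₘ Y2 → d ∈ₘ Y1 → a ∈ₘ d → b ∈ₘ d → c ∈ₘ d →
        (φ a b c d ↔ ∃ d, d ∈ₘ Y1 ∧ a ∈ₘ d ∧ b ∈ₘ d ∧ c ∈ₘ d ∧ φ a b c d) := by
      intro a b c d ha hb hc hd h1 h2 h3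
      refine ⟨fun k => ⟨d, hd, h1, h2, h3, k⟩, ?_⟩
      rintro ⟨d', hd', h1', h2', h3', k⟩
      exact (k1 a b c d' d (s2 a ha) (s2 b hb) (s2 c hc) hd' hd h1' h2' h3' h1 h2 h3).1 k
    have e2 : ∀ {a b c}, a ∈ₘ Y2 → b ∈ₘ Y2 → c ∈ₘ Y2 → a ∈ₘ c → b ∈ₘ c →
        ((∃ d, d ∈ₘ Y1 ∧ a ∈ₘ d ∧ b ∈ₘ d ∧ c ∈ₘ d ∧ φ a b c d) ↔
          ∃ c, c ∈ₘ Y2 ∧ a ∈ₘ c ∧ b ∈ₘ c ∧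
            ∃ d, d ∈ₘ Y1 ∧ a ∈ₘ d ∧ b ∈ₘ d ∧ c ∈ₘ d ∧ φ a b c d) := by
      intro a b c ha hb hc h1 h2
      refine ⟨fun k => ⟨c, hc, h1, h2, k⟩, ?_⟩
      rintro ⟨c', hc', h1', h2', k⟩
      exact (k2 a b b c' c ha hb hb hc' hc h1' h2' h2' h1 h2 h2).1 k
    rw [e3 (s3 a ha) (s3 b hb) (s3 c hc) (s2 d (s3 d hd)) had hbd hcd,
      e2 (s3 a ha) (s3 b hb) (s3 c hc) hac hbc]
    refine ⟨fun k => ⟨b, hb, hab, k⟩, ?_⟩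
    rintro ⟨b', hb', h1', k⟩
    exact (k3 a a a b' b ha ha ha hb' hb h1' h1' h1' hab hab hab).1 k
  -- Only the dependence on the first element is left, and the pigeonhole principle removes it.
  obtain ⟨t, ht, k⟩ := h.unbounded_class_of_prop u3
    fun a : M => ∃ b, b ∈ₘ Y3 ∧ a ∈ₘ b ∧ ∃ c, c ∈ₘ Y2 ∧ a ∈ₘ c ∧ b ∈ₘ c ∧
      ∃ d, d ∈ₘ Y1 ∧ a ∈ₘ d ∧ b ∈ₘ d ∧ c ∈ₘ d ∧ φ a b c d
  obtain ⟨Y, -, hY⟩ := h.sep Y3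
    (fun a : M => (∃ b, b ∈ₘ Y3 ∧ a ∈ₘ b ∧ ∃ c, c ∈ₘ Y2 ∧ a ∈ₘ c ∧ b ∈ₘ c ∧
      ∃ d, d ∈ₘ Y1 ∧ a ∈ₘ d ∧ b ∈ₘ d ∧ c ∈ₘ d ∧ φ a b c d) ↔
      ∃ b, b ∈ₘ Y3 ∧ t ∈ₘ b ∧ ∃ c, c ∈ₘ Y2 ∧ t ∈ₘ c ∧ b ∈ₘ c ∧
      ∃ d, d ∈ₘ Y1 ∧ t ∈ₘ d ∧ b ∈ₘ d ∧ c ∈ₘ d ∧ φ t b c d)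
  have sY : Sub Y Y3 := fun z hz => ((hY z).1 hz).1
  refine ⟨Y, ⟨fun x hx => u3.1 x (sY x hx), fun n hn => ?_⟩,
    fun z hz => s1 z (s2 z (s3 z (sY z hz))), ?_⟩
  · obtain ⟨x, hx, e, hnx⟩ := k n hn
    exact ⟨x, (hY x).2 ⟨hx, e⟩, hnx⟩
  · intro a b c d a' b' c' d' ha hb hc hd ha' hb' hc' hd' hab hbc hcd hab' hbc' hcd' H
    refine (key a' b' c' d' (sY _ ha') (sY _ hb') (sY _ hc') (sY _ hd') hab' hbc' hcd').2 ?_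
    refine ((hY a').1 ha').2.2 (((hY a).1 ha).2.1 ?_)
    exact (key a b c d (sY _ ha) (sY _ hb) (sY _ hc) (sY _ hd) hab hbc hcd).1 H

end IsZFA
end SetStructure

/-! ### From constant patterns to canonical colorings; Dedekind-infinite sets -/

namespace SetStructure

section
variable {M : Type u} [SetStructure M]

/-- The conclusion of the Canonical Ramsey Theorem for the coloring `f` of the pairs from `X`. -/
def HasCanonicalSubset (X f : M) : Prop :=
  ∃ Y R, IsSet Y ∧ Sub Y X ∧ ¬ IsFinite Y ∧ IsLinearOrdering R Y ∧
    ((∀ a₁ b₁ a₂ b₂, Rel R a₁ b₁ → Rel R a₂ b₂ → SameColor f a₁ b₁ a₂ b₂) ∨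
     (∀ a₁ b₁ a₂ b₂, Rel R a₁ b₁ → Rel R a₂ b₂ → (SameColor f a₁ b₁ a₂ b₂ ↔ a₁ = a₂)) ∨
     (∀ a₁ b₁ a₂ b₂, Rel R a₁ b₁ → Rel R a₂ b₂ → (SameColor f a₁ b₁ a₂ b₂ ↔ b₁ = b₂)) ∨
     (∀ a₁ b₁ a₂ b₂, Rel R a₁ b₁ → Rel R a₂ b₂ →
        (SameColor f a₁ b₁ a₂ b₂ ↔ a₁ = a₂ ∧ b₁ = b₂)))

theorem SameColor.symm {f a b c d : M} (k : SameColor f a b c d) : SameColor f c d a b := by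
  obtain ⟨s, t, e, hs, ht, hse, hte⟩ := k
  exact ⟨t, s, e, ht, hs, hte, hse⟩

open Classical in
/-- The elements of a set that is linearly ordered by `R`, as a linear order. -/
noncomputable abbrev IsLinearOrdering.linearOrder {R X : M} (hR : IsLinearOrdering R X) :
    LinearOrder {x // x ∈ₘ X} :=
  haveI : IsStrictTotalOrder {x // x ∈ₘ X} (fun a b => Rel R a.1 b.1) :=
    { trichotomous := fun a b k k' => by
        rcases hR.2.2.2 a.1 b.1 a.2 b.2 with e | e | e
        exacts [(k e).elim, Subtype.ext e, (k' e).elim]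
      irrefl := fun a => hR.2.1 a.1
      trans := fun a b c => hR.2.2.1 a.1 b.1 c.1 }
  linearOrderOfSTO (fun a b : {x // x ∈ₘ X} => Rel R a.1 b.1)

end

namespace IsZFA
variable {M : Type u} [SetStructure M] (h : IsZFA M)
include h

/-! ### Finite sets -/

theorem exists_numeral (m : ℕ) : ∃ k : M, IsNumeral m k := by
  induction m with
  | zero => exact h.exists_empty
  | succ m ih =>
    obtain ⟨k, hk⟩ := ih
    obtain ⟨l, hl⟩ := h.exists_succ k
    exact ⟨l, k, hk, hl⟩

theorem numeral_unique {m : ℕ} {k l : M} (hk : IsNumeral m k) (hl : IsNumeral m l) : k = l := by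
  induction m generalizing k l with
  | zero => exact h.empty_unique hk hl
  | succ m ih =>
    obtain ⟨k', hk', hk⟩ := hk
    obtain ⟨l', hl', hl⟩ := hl
    obtain rfl := ih hk' hl'
    exact h.succ_unique hk hl

theorem mem_numeral {m : ℕ} {k : M} (hk : IsNumeral m k) (z : M) :
    z ∈ₘ k ↔ ∃ j < m, IsNumeral j z := by
  induction m generalizing k with
  | zero => exact iff_of_false (hk.2 z) (by simp)
  | succ m ih =>
    obtain ⟨k', hk', hk⟩ := hk
    refine (hk.2 z).trans ⟨?_, ?_⟩
    · rintro (hz | rfl)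
      · obtain ⟨j, hj, hz⟩ := (ih hk').1 hz
        exact ⟨j, hj.trans m.lt_succ_self, hz⟩
      · exact ⟨m, m.lt_succ_self, hk'⟩
    · rintro ⟨j, hj, hz⟩
      rcases (Nat.lt_succ_iff_lt_or_eq.1 hj) with hj | rfl
      · exact Or.inl ((ih hk').2 ⟨j, hj, hz⟩)
      · exact Or.inr (h.numeral_unique hz hk')

theorem numeral_isNat {m : ℕ} {k : M} (hk : IsNumeral m k) : IsNat k := by
  induction m generalizing k with
  | zero => exact h.nat_zero hk
  | succ m ih =>
    obtain ⟨k', hk', hk⟩ := hk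
    exact h.nat_succ (ih hk') hk

theorem numeral_inj {i j : ℕ} {k : M} (hi : IsNumeral i k) (hj : IsNumeral j k) : i = j := by
  rcases lt_trichotomy i j with e | e | e
  · exact (h.notMem_self k ((h.mem_numeral hj k).2 ⟨i, e, hi⟩)).elim
  · exact e
  · exact (h.notMem_self k ((h.mem_numeral hi k).2 ⟨j, e, hj⟩)).elim

/-- For a standard number m, being of size m inside `M` is the same as having an actual enumeration
by `Fin m`. This makes external finite combinatorics available for pairs and 4-sets. -/
theorem exists_bij_numeral_iff (m : ℕ) (s : M) :
    (∃ k f, IsNumeral m k ∧ IsBij f k s) ↔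
      ∃ e : Fin m → M, Function.Injective e ∧ ∀ z, z ∈ₘ s ↔ ∃ i, e i = z := by
  constructor
  · rintro ⟨k, f, hk, ⟨⟨hf, hf'⟩, hinj⟩, hsurj⟩
    choose num hnum using fun j => h.exists_numeral (M := M) j
    have hmem : ∀ i : Fin m, num i ∈ₘ k := fun i => (h.mem_numeral hk _).2 ⟨i, i.2, hnum i⟩
    choose e he he' using fun i : Fin m => hf' (num i) (hmem i)
    refine ⟨e, fun i j hij => ?_, fun z => ⟨fun hz => ?_, ?_⟩⟩
    · have := hinj _ _ _ (he i) (hij ▸ he j)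
      exact Fin.ext (h.numeral_inj (this ▸ hnum i) (hnum j))
    · obtain ⟨a, ha⟩ := hsurj z hz
      obtain ⟨j, hj, haj⟩ := (h.mem_numeral hk a).1 (h.rel_mem hf ha).1
      obtain rfl := h.numeral_unique haj (hnum j)
      exact ⟨⟨j, hj⟩, (he' ⟨j, hj⟩ z ha).symm⟩
    · rintro ⟨i, rfl⟩
      exact (h.rel_mem hf (he i)).2
  · rintro ⟨e, hinj, he⟩
    obtain ⟨k, hk⟩ := h.exists_numeral m
    obtain ⟨f, hf, hrel⟩ := h.exists_relation k s (fun a b => ∃ i : Fin m, IsNumeral i a ∧ b = e i)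
    refine ⟨k, f, hk, ⟨⟨hf, fun a ha => ?_⟩, ?_⟩, ?_⟩
    · obtain ⟨j, hj, haj⟩ := (h.mem_numeral hk a).1 ha
      refine ⟨e ⟨j, hj⟩, (hrel _ _).2 ⟨ha, (he _).2 ⟨_, rfl⟩, ⟨j, hj⟩, haj, rfl⟩, fun b hb => ?_⟩
      obtain ⟨-, -, i, hi, rfl⟩ := (hrel _ _).1 hb
      exact congrArg e (Fin.ext (h.numeral_inj hi haj))
    · intro a a' b ha ha'
      obtain ⟨-, -, i, hi, rfl⟩ := (hrel _ _).1 ha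
      obtain ⟨-, -, j, hj, e'⟩ := (hrel _ _).1 ha'
      obtain rfl := hinj e'
      exact h.numeral_unique hi hj
    · intro b hb
      obtain ⟨i, rfl⟩ := (he b).1 hb
      obtain ⟨a, ha⟩ := h.exists_numeral (M := M) i
      exact ⟨a, (hrel _ _).2 ⟨(h.mem_numeral hk a).2 ⟨i, i.2, ha⟩, hb, i, ha, rfl⟩⟩

/-- An actual finite enumeration is an element of `M`. The converse may fail if ω is nonstandard,
but it is not needed in a general model. -/
theorem infinite_of_not_isFinite {X : M} (hX : ¬ IsFinite X) : Infinite {x // x ∈ₘ X} := by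
  by_contra hc
  rw [not_infinite_iff_finite] at hc
  obtain ⟨m, ⟨e⟩⟩ := Finite.exists_equiv_fin {x // x ∈ₘ X}
  obtain ⟨k, f, hk, hf⟩ := (h.exists_bij_numeral_iff m X).2 ⟨fun i => (e.symm i).1,
    fun i j hij => e.symm.injective (Subtype.ext hij),
    fun z => ⟨fun hz => ⟨e ⟨z, hz⟩, by simp⟩, by rintro ⟨i, rfl⟩; exact (e.symm i).2⟩⟩
  exact hX ⟨k, f, h.numeral_isNat hk, hf⟩

theorem isFinite_insert {X Z m : M} (hZ : IsFinite Z) (hm : ¬ m ∈ₘ Z)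
    (hX : ∀ z, z ∈ₘ X ↔ z ∈ₘ Z ∨ z = m) : IsFinite X := by
  obtain ⟨n, f, hn, ⟨⟨hf, hf'⟩, hinj⟩, hsurj⟩ := hZ
  obtain ⟨n', hn'⟩ := h.exists_succ n
  obtain ⟨g, hg, hrel⟩ := h.exists_relation n' X (fun a b => Rel f a b ∨ (a = n ∧ b = m))
  have hnf : ∀ b, ¬ Rel f n b := fun b k => h.notMem_self n (h.rel_mem hf k).1
  have hmf : ∀ a, ¬ Rel f a m := fun a k => hm (h.rel_mem hf k).2
  have hrel' : ∀ a b, Rel g a b ↔ Rel f a b ∨ (a = n ∧ b = m) := by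
    refine fun a b => (hrel a b).trans ⟨fun k => k.2.2, fun k => ?_⟩
    rcases k with k | ⟨rfl, rfl⟩
    · have := h.rel_mem hf k
      exact ⟨(hn'.2 a).2 (Or.inl this.1), (hX b).2 (Or.inl this.2), Or.inl k⟩
    · exact ⟨(hn'.2 _).2 (Or.inr rfl), (hX _).2 (Or.inr rfl), Or.inr ⟨rfl, rfl⟩⟩
  refine ⟨n', g, h.nat_succ hn hn', ⟨⟨hg, fun a ha => ?_⟩, ?_⟩, fun b hb => ?_⟩
  · rcases (hn'.2 a).1 ha with ha | rfl
    · obtain ⟨b, hb, hu⟩ := hf' a ha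
      refine ⟨b, (hrel' a b).2 (Or.inl hb), fun b' hb' => ?_⟩
      rcases (hrel' a b').1 hb' with k | ⟨rfl, -⟩
      exacts [hu b' k, (hnf _ hb).elim]
    · refine ⟨m, (hrel' _ _).2 (Or.inr ⟨rfl, rfl⟩), fun b' hb' => ?_⟩
      rcases (hrel' _ b').1 hb' with k | ⟨-, k⟩
      exacts [(hnf _ k).elim, k]
  · intro a a' b k k'
    rcases (hrel' _ _).1 k with k | ⟨rfl, rfl⟩
    · rcases (hrel' _ _).1 k' with k' | ⟨rfl, rfl⟩
      exacts [hinj _ _ _ k k', (hmf _ k).elim]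
    · rcases (hrel' _ _).1 k' with k' | ⟨rfl, -⟩
      exacts [(hmf _ k').elim, rfl]
  · rcases (hX b).1 hb with hb | rfl
    · obtain ⟨a, ha⟩ := hsurj b hb
      exact ⟨a, (hrel' _ _).2 (Or.inl ha)⟩
    · exact ⟨n, (hrel' _ _).2 (Or.inr ⟨rfl, rfl⟩)⟩

theorem upair_mem_subsets {X P a b s : M} (hP : IsSubsetsOfSize 2 X P) (ha : a ∈ₘ X) (hb : b ∈ₘ X)
    (hab : a ≠ b) (hs : IsUPair s a b) : s ∈ₘ P := by
  refine (hP.2 s).2 ⟨hs.1, fun z hz => ?_, (h.exists_bij_numeral_iff 2 s).2 ⟨![a, b], ?_, ?_⟩⟩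
  · rcases (hs.2 z).1 hz with rfl | rfl <;> assumption
  · intro i j hij
    fin_cases i <;> fin_cases j <;> simp_all [eq_comm]
  · intro z
    rw [hs.2 z, Fin.exists_fin_two]
    exact or_congr eq_comm eq_comm

/-! ### Same color is an equivalence relation between pairs -/

theorem sameColor_refl {X P C f a b : M} (hP : IsSubsetsOfSize 2 X P) (hf : IsFun f P C)
    (ha : a ∈ₘ X) (hb : b ∈ₘ X) (hab : a ≠ b) : SameColor f a b a b := by
  obtain ⟨s, hs⟩ := h.pairing a b
  obtain ⟨c, hc, -⟩ := hf.2 s (h.upair_mem_subsets hP ha hb hab hs)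
  exact ⟨s, s, c, hs, hs, hc, hc⟩

theorem sameColor_trans {P C f a₁ b₁ a₂ b₂ a₃ b₃ : M} (hf : IsFun f P C)
    (k : SameColor f a₁ b₁ a₂ b₂) (k' : SameColor f a₂ b₂ a₃ b₃) : SameColor f a₁ b₁ a₃ b₃ := by
  obtain ⟨s₁, s₂, c, hs₁, hs₂, hc, hc'⟩ := k
  obtain ⟨t₂, t₃, d, ht₂, ht₃, hd, hd'⟩ := k'
  obtain rfl := h.upair_unique hs₂ ht₂
  obtain rfl := (hf.2 s₂ (h.rel_mem hf.1 hc').1).unique hc' hd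
  exact ⟨s₁, t₃, c, hs₁, ht₃, hc, hd'⟩

/-- The restriction of a linear ordering to a subset. -/
theorem exists_restrict {R Y Z : M} (hR : IsLinearOrdering R Y) (hZ : Sub Z Y) :
    ∃ S, IsLinearOrdering S Z ∧ ∀ a b, Rel S a b ↔ a ∈ₘ Z ∧ b ∈ₘ Z ∧ Rel R a b := by
  obtain ⟨S, hS, k⟩ := h.exists_relation Z Z (fun a b => Rel R a b)
  refine ⟨S, ⟨hS, fun a ha => hR.2.1 a ((k a a).1 ha).2.2, fun a b c hab hbc => ?_,
    fun a b ha hb => ?_⟩, k⟩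
  · obtain ⟨ha, -, hab⟩ := (k a b).1 hab
    obtain ⟨-, hc, hbc⟩ := (k b c).1 hbc
    exact (k a c).2 ⟨ha, hc, hR.2.2.1 _ _ _ hab hbc⟩
  · rcases hR.2.2.2 a b (hZ a ha) (hZ b hb) with e | e | e
    exacts [Or.inl ((k a b).2 ⟨ha, hb, e⟩), Or.inr (Or.inl e),
      Or.inr (Or.inr ((k b a).2 ⟨hb, ha, e⟩))]

/-- Discarding a possible greatest element leaves an infinite set. The purpose is that a triple from
Z can always be completed to an increasing quadruple from Y. -/
theorem exists_infinite_below {R Y : M} (hYs : IsSet Y) (hY : ¬ IsFinite Y)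
    (hR : IsLinearOrdering R Y) :
    ∃ Z, IsSet Z ∧ Sub Z Y ∧ ¬ IsFinite Z ∧ ∀ c, c ∈ₘ Z → ∃ d, d ∈ₘ Y ∧ Rel R c d := by
  by_cases hmax : ∃ m, m ∈ₘ Y ∧ ∀ c, c ∈ₘ Y → ¬ Rel R m c
  · obtain ⟨m, hm, hmax⟩ := hmax
    obtain ⟨Z, hZ, k⟩ := h.sep Y (fun z => z ≠ m)
    refine ⟨Z, hZ, fun z hz => ((k z).1 hz).1, fun hfin => hY ?_, fun c hc => ⟨m, hm, ?_⟩⟩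
    · refine h.isFinite_insert hfin (fun hmZ => ((k m).1 hmZ).2 rfl) fun z => ⟨fun hz => ?_, ?_⟩
      · by_cases e : z = m
        exacts [Or.inr e, Or.inl ((k z).2 ⟨hz, e⟩)]
      · rintro (hz | rfl)
        exacts [((k z).1 hz).1, hm]
    · obtain ⟨hc, hne⟩ := (k c).1 hc
      rcases hR.2.2.2 c m hc hm with e | e | e
      exacts [e, (hne e).elim, (hmax c hc e).elim]
  · push Not at hmax
    exact ⟨Y, hYs, fun _ hz => hz, hY, hmax⟩

/-- An infinite linearly ordered set on which the pattern of the coloring is constant yields an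
infinite set on which the coloring is canonical. -/
theorem hasCanonicalSubset_of_patternOn {X P C f Y R : M} (hP : IsSubsetsOfSize 2 X P)
    (hf : IsFun f P C) (hYs : IsSet Y) (hYX : Sub Y X) (hY : ¬ IsFinite Y)
    (hR : IsLinearOrdering R Y) (pat : PatternOn (Rel R) Y (SameColor f)) :
    HasCanonicalSubset X f := by
  obtain ⟨Z, hZs, hZY, hZ, above⟩ := h.exists_infinite_below hYs hY hR
  obtain ⟨S, hS, hSrel⟩ := h.exists_restrict hR hZY
  refine ⟨Z, S, hZs, fun z hz => hYX z (hZY z hz), hZ, hS, ?_⟩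
  let _ := hS.linearOrder
  have lt_iff : ∀ a b : {x // x ∈ₘ Z}, a < b ↔ Rel S a.1 b.1 := fun _ _ => Iff.rfl
  have lt_R : ∀ {a b : {x // x ∈ₘ Z}}, a < b → Rel R a.1 b.1 := fun k =>
    ((hSrel _ _).1 ((lt_iff _ _).1 k)).2.2
  have inf := h.infinite_of_not_isFinite hZ
  have hom4 : ∀ φ, HomOn (Rel R) Y φ →
      Hom4 fun a b c d : {x // x ∈ₘ Z} => φ a.1 b.1 c.1 d.1 := by
    intro φ k a b c d a' b' c' d' h1 h2 h3 h1' h2' h3'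
    exact k a.1 b.1 c.1 d.1 a'.1 b'.1 c'.1 d'.1 (hZY _ a.2) (hZY _ b.2) (hZY _ c.2) (hZY _ d.2)
      (hZY _ a'.2) (hZY _ b'.2) (hZY _ c'.2) (hZY _ d'.2) (lt_R h1) (lt_R h2) (lt_R h3) (lt_R h1')
      (lt_R h2') (lt_R h3')
  -- Three-point patterns were stated for quadruples, so each triple borrows a fourth point above
  -- it, possibly outside Z.
  have hom3 : ∀ φ : M → M → M → Prop, HomOn (Rel R) Y (fun a b c _ => φ a b c) →
      Hom3 fun a b c : {x // x ∈ₘ Z} => φ a.1 b.1 c.1 := by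
    intro φ k a b c a' b' c' h1 h2 h1' h2'
    obtain ⟨d, hd, hcd⟩ := above c.1 c.2
    obtain ⟨d', hd', hcd'⟩ := above c'.1 c'.2
    exact k a.1 b.1 c.1 d a'.1 b'.1 c'.1 d' (hZY _ a.2) (hZY _ b.2) (hZY _ c.2) hd
      (hZY _ a'.2) (hZY _ b'.2) (hZY _ c'.2) hd' (lt_R h1) (lt_R h2) hcd (lt_R h1')
      (lt_R h2') hcd'
  have five : ∃ a b c d e : {x // x ∈ₘ Z}, a < b ∧ b < c ∧ c < d ∧ d < e := by
    obtain ⟨s, hs⟩ := Infinite.exists_subset_card_eq {x // x ∈ₘ Z} 5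
    let g := s.orderEmbOfFin hs
    exact ⟨g 0, g 1, g 2, g 3, g 4, g.lt_iff_lt.2 (by decide), g.lt_iff_lt.2 (by decide),
      g.lt_iff_lt.2 (by decide), g.lt_iff_lt.2 (by decide)⟩
  have key := canonical_of_hom (fun a b c d : {x // x ∈ₘ Z} => SameColor f a.1 b.1 c.1 d.1)
    (fun a b hab => h.sameColor_refl hP hf (hYX _ (hZY _ a.2)) (hYX _ (hZY _ b.2))
      fun e => hab.ne (Subtype.ext e))
    (fun _ _ _ _ k => k.symm) (fun _ _ _ _ _ _ k k' => h.sameColor_trans hf k k')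
    (hom3 _ pat.left) (hom3 _ pat.right) (hom3 _ pat.mid) (hom4 _ pat.disj) (hom4 _ pat.cross)
    (hom4 _ pat.nest) five
  have mem : ∀ {a b}, Rel S a b → a ∈ₘ Z ∧ b ∈ₘ Z := fun k => h.rel_mem hS.1 k
  refine key.imp (fun k a b c d hab hcd => ?_) (Or.imp (fun k a b c d hab hcd => ?_)
    (Or.imp (fun k a b c d hab hcd => ?_) (fun k a b c d hab hcd => ?_)))
  · exact k ⟨a, (mem hab).1⟩ ⟨b, (mem hab).2⟩ ⟨c, (mem hcd).1⟩ ⟨d, (mem hcd).2⟩ hab hcd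
  · exact (k ⟨a, (mem hab).1⟩ ⟨b, (mem hab).2⟩ ⟨c, (mem hcd).1⟩ ⟨d, (mem hcd).2⟩ hab hcd).trans
      Subtype.mk_eq_mk
  · exact (k ⟨a, (mem hab).1⟩ ⟨b, (mem hab).2⟩ ⟨c, (mem hcd).1⟩ ⟨d, (mem hcd).2⟩ hab hcd).trans
      Subtype.mk_eq_mk
  · exact (k ⟨a, (mem hab).1⟩ ⟨b, (mem hab).2⟩ ⟨c, (mem hcd).1⟩ ⟨d, (mem hcd).2⟩ hab hcd).trans
      (and_congr Subtype.mk_eq_mk Subtype.mk_eq_mk)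

/-! ### Dedekind-infinite sets -/

/-- By induction on n, the preimages under i of the elements listed by g up to n stay below some
natural number, whereas `H` is unbounded. -/
theorem not_isFinite_image {w X i H Y : M} (hw : IsOmega w) (hi : IsInj i w X)
    (hH : IsUnbounded H) (hY : ∀ y, y ∈ₘ Y ↔ ∃ j, j ∈ₘ H ∧ Rel i j y) : ¬ IsFinite Y := by
  rintro ⟨n, g, hn, ⟨⟨hg, hg'⟩, -⟩, hsurj⟩
  have bound : ∃ u, IsNat u ∧ ∀ k, k ∈ₘ n → ∀ j y, Rel g k y → Rel i j y → j ∈ₘ u := by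
    refine h.nat_induction (fun n => ∃ u, IsNat u ∧
      ∀ k, k ∈ₘ n → ∀ j y, Rel g k y → Rel i j y → j ∈ₘ u)
      (fun e he => ⟨e, h.nat_zero he, fun k hk => (he.2 k hk).elim⟩) (fun l m hl ih hm => ?_) hn
    obtain ⟨u, hu, ih⟩ := ih
    by_cases hc : ∃ j y, Rel g l y ∧ Rel i j y
    · obtain ⟨j, y, hly, hjy⟩ := hc
      have hj : IsNat j := (hw.2 j).1 (h.rel_mem hi.1.1 hjy).1
      obtain ⟨v, hv, huv, hjv⟩ := h.nat_max hu hj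
      refine ⟨v, hv, fun k hk j' y' hk' hj' => ?_⟩
      rcases (hm.2 k).1 hk with hk | rfl
      · exact h.nat_trans hv (ih k hk j' y' hk' hj') huv
      · obtain rfl := (hg' k (h.rel_mem hg hly).1).unique hly hk'
        obtain rfl := hi.2 _ _ _ hjy hj'
        exact hjv
    · refine ⟨u, hu, fun k hk j' y' hk' hj' => ?_⟩
      rcases (hm.2 k).1 hk with hk | rfl
      · exact ih k hk j' y' hk' hj'
      · exact (hc ⟨j', y', hk', hj'⟩).elim
  obtain ⟨u, hu, bound⟩ := bound
  obtain ⟨j, hj, huj⟩ := hH.2 u hu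
  obtain ⟨y, hy, -⟩ := hi.1.2 j ((hw.2 j).2 (hH.1 j hj))
  obtain ⟨k, hk⟩ := hsurj y ((hY y).2 ⟨j, hj, hy⟩)
  exact h.nat_asymm hu (bound k (h.rel_mem hg hk).1 j y hk hy) huj

/-- The Canonical Ramsey Theorem for Dedekind-infinite sets. -/
theorem hasCanonicalSubset_of_inj {w i X P C f : M} (hw : IsOmega w) (hi : IsInj i w X)
    (hP : IsSubsetsOfSize 2 X P) (hf : IsFun f P C) : HasCanonicalSubset X f := by
  -- The coloring is pulled back to ω along i, with membership as the order. The image of `H`,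
  -- ordered through i, then inherits the patterns.
  obtain ⟨H, hH, -, pat⟩ := exists_patternOn IsUnbounded mem
    (fun φ hφ X hX => h.exists_homOn_unbounded φ hφ hX)
    (fun a b c d => ∃ a' b' c' d', Rel i a a' ∧ Rel i b b' ∧ Rel i c c' ∧ Rel i d d' ∧
      SameColor f a' b' c' d') (by intro _ _ _ _ _ _ _ _ _; infer_instance) (X := w)
    ⟨fun x hx => (hw.2 x).1 hx, fun n hn => by
      obtain ⟨m, hm⟩ := h.exists_succ n
      exact ⟨m, (hw.2 m).2 (h.nat_succ hn hm), (hm.2 n).2 (Or.inr rfl)⟩⟩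
  have hHw : ∀ j, j ∈ₘ H → j ∈ₘ w := fun j hj => (hw.2 j).2 (hH.1 j hj)
  obtain ⟨Y, hYs, hY⟩ := h.sep X (fun y => ∃ j, j ∈ₘ H ∧ Rel i j y)
  have hY' : ∀ y, y ∈ₘ Y ↔ ∃ j, j ∈ₘ H ∧ Rel i j y := fun y => (hY y).trans
    (and_iff_right_of_imp fun ⟨j, _, k⟩ => (h.rel_mem hi.1.1 k).2)
  obtain ⟨R, hR, hRrel⟩ := h.exists_relation Y Y
    (fun y z => ∃ j k, j ∈ₘ H ∧ k ∈ₘ H ∧ Rel i j y ∧ Rel i k z ∧ j ∈ₘ k)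
  have uniq : ∀ {j y z}, Rel i j y → Rel i j z → y = z := fun {j y z} hy hz =>
    (hi.1.2 j (h.rel_mem hi.1.1 hy).1).unique hy hz
  have inj : ∀ {j k y}, Rel i j y → Rel i k y → j = k := fun hy hz => hi.2 _ _ _ hy hz
  have rel : ∀ {y z j k}, Rel i j y → Rel i k z → Rel R y z → j ∈ₘ k := by
    intro y z j k hj hk hR
    obtain ⟨-, -, j', k', -, -, hj', hk', hjk⟩ := (hRrel y z).1 hR
    obtain rfl := inj hj hj'
    obtain rfl := inj hk hk'
    exact hjk
  have linear : IsLinearOrdering R Y := by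
    refine ⟨hR, fun a ha => ?_, fun a b c hab hbc => ?_, fun a b ha hb => ?_⟩
    · obtain ⟨-, -, j, k, -, -, hj, hk, hjk⟩ := (hRrel a a).1 ha
      obtain rfl := inj hj hk
      exact h.notMem_self j hjk
    · obtain ⟨ha, -, j, k, hjH, hkH, hj, hk, hjk⟩ := (hRrel a b).1 hab
      obtain ⟨-, hc, k', l, -, hlH, hk', hl, hkl⟩ := (hRrel b c).1 hbc
      obtain rfl := inj hk hk'
      exact (hRrel a c).2 ⟨ha, hc, j, l, hjH, hlH, hj, hl, h.nat_trans (hH.1 l hlH) hjk hkl⟩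
    · obtain ⟨j, hjH, hj⟩ := (hY' a).1 ha
      obtain ⟨k, hkH, hk⟩ := (hY' b).1 hb
      rcases h.nat_trichotomy (hH.1 j hjH) (hH.1 k hkH) with e | rfl | e
      · exact Or.inl ((hRrel a b).2 ⟨ha, hb, j, k, hjH, hkH, hj, hk, e⟩)
      · exact Or.inr (Or.inl (uniq hj hk))
      · exact Or.inr (Or.inr ((hRrel b a).2 ⟨hb, ha, k, j, hkH, hjH, hk, hj, e⟩))
  have transfer : ∀ φ ψ : M → M → M → M → Prop,
      (∀ a b c d a' b' c' d', Rel i a a' → Rel i b b' → Rel i c c' → Rel i d d' →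
        (φ a b c d ↔ ψ a' b' c' d')) → HomOn mem H φ → HomOn (Rel R) Y ψ := by
    intro φ ψ e k a b c d a' b' c' d' ha hb hc hd ha' hb' hc' hd' h1 h2 h3 h1' h2' h3' H
    obtain ⟨ja, hja, ia⟩ := (hY' a).1 ha
    obtain ⟨jb, hjb, ib⟩ := (hY' b).1 hb
    obtain ⟨jc, hjc, ic⟩ := (hY' c).1 hc
    obtain ⟨jd, hjd, id⟩ := (hY' d).1 hd
    obtain ⟨ja', hja', ia'⟩ := (hY' a').1 ha'
    obtain ⟨jb', hjb', ib'⟩ := (hY' b').1 hb'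
    obtain ⟨jc', hjc', ic'⟩ := (hY' c').1 hc'
    obtain ⟨jd', hjd', id'⟩ := (hY' d').1 hd'
    exact (e _ _ _ _ _ _ _ _ ia' ib' ic' id').1 (k _ _ _ _ _ _ _ _ hja hjb hjc hjd hja' hjb' hjc'
      hjd' (rel ia ib h1) (rel ib ic h2) (rel ic id h3) (rel ia' ib' h1') (rel ib' ic' h2')
      (rel ic' id' h3') ((e _ _ _ _ _ _ _ _ ia ib ic id).2 H))
  have color : ∀ {a b c d a' b' c' d'}, Rel i a a' → Rel i b b' → Rel i c c' → Rel i d d' →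
      ((∃ a' b' c' d', Rel i a a' ∧ Rel i b b' ∧ Rel i c c' ∧ Rel i d d' ∧
        SameColor f a' b' c' d') ↔ SameColor f a' b' c' d') := by
    intro a b c d a' b' c' d' ha hb hc hd
    refine ⟨?_, fun k => ⟨a', b', c', d', ha, hb, hc, hd, k⟩⟩
    rintro ⟨a'', b'', c'', d'', ha', hb', hc', hd', k⟩
    obtain rfl := uniq ha ha'
    obtain rfl := uniq hb hb'
    obtain rfl := uniq hc hc'
    obtain rfl := uniq hd hd'
    exact k
  refine h.hasCanonicalSubset_of_patternOn hP hf hYs (fun y hy => ((hY y).1 hy).1)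
    (h.not_isFinite_image hw hi hH hY') linear ⟨?_, ?_, ?_, ?_, ?_, ?_⟩
  · exact transfer _ _ (fun _ _ _ _ _ _ _ _ ha hb hc hd => color ha hb ha hc) pat.left
  · exact transfer _ _ (fun _ _ _ _ _ _ _ _ ha hb hc hd => color ha hc hb hc) pat.right
  · exact transfer _ _ (fun _ _ _ _ _ _ _ _ ha hb hc hd => color ha hb hb hc) pat.mid
  · exact transfer _ _ (fun _ _ _ _ _ _ _ _ ha hb hc hd => color ha hb hc hd) pat.disj
  · exact transfer _ _ (fun _ _ _ _ _ _ _ _ ha hb hc hd => color ha hc hb hd) pat.cross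
  · exact transfer _ _ (fun _ _ _ _ _ _ _ _ ha hb hc hd => color ha hd hb hc) pat.nest

theorem crt_of_dfeqf (hD : DFeqF M) : CRT M := by
  intro X P C f hXs hX hP _ hf
  have : ∃ w i, IsOmega w ∧ IsInj i w X := by
    by_contra hc
    exact hX (hD X hXs hc)
  obtain ⟨w, i, hw, hi⟩ := this
  exact h.hasCanonicalSubset_of_inj hw hi hP hf

end IsZFA
end SetStructure

/-! ### CRT from the Ordering Principle and Ramsey's theorem for 4-sets -/

namespace SetStructure

theorem strictMono_quadruple {α : Type*} [Preorder α] {a b c d : α} (hab : a < b) (hbc : b < c)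
    (hcd : c < d) : StrictMono ![a, b, c, d] := by
  refine Fin.strictMono_iff_lt_succ.2 fun i => ?_
  fin_cases i
  exacts [hab, hbc, hcd]

/-- Two increasing enumerations of the same four elements of a linear order agree. -/
theorem increasing_quadruple_unique {α : Type*} [LinearOrder α] {a b c d a' b' c' d' : α}
    (hab : a < b) (hbc : b < c) (hcd : c < d) (hab' : a' < b') (hbc' : b' < c') (hcd' : c' < d')
    (e : ∀ z, (z = a ∨ z = b ∨ z = c ∨ z = d) ↔ (z = a' ∨ z = b' ∨ z = c' ∨ z = d')) :
    a = a' ∧ b = b' ∧ c = c' ∧ d = d' := by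
  have key : (![a, b, c, d] : Fin 4 → α) = ![a', b', c', d'] := by
    refine (StrictMono.range_inj (strictMono_quadruple hab hbc hcd)
      (strictMono_quadruple hab' hbc' hcd')).1 ?_
    ext z
    have := e z
    simp only [Matrix.range_cons, Matrix.range_empty, Set.union_empty, Set.mem_union,
      Set.mem_singleton_iff]
    tauto
  exact ⟨congrFun key 0, congrFun key 1, congrFun key 2, congrFun key 3⟩

namespace IsZFA
variable {M : Type u} [SetStructure M] (h : IsZFA M)
include h

theorem exists_subsetsOfSize (m : ℕ) (X : M) : ∃ P, IsSubsetsOfSize m X P := by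
  obtain ⟨Q, -, hQ⟩ := h.power X
  obtain ⟨P, hP, k⟩ := h.sep Q (fun s => ∃ k f, IsNumeral m k ∧ IsBij f k s)
  exact ⟨P, hP, fun s => (k s).trans ((and_congr_left' (hQ s)).trans and_assoc)⟩

theorem exists_quadruple {X P R a b c d : M} (hP : IsSubsetsOfSize 4 X P)
    (hR : IsLinearOrdering R X) (ha : a ∈ₘ X) (hb : b ∈ₘ X) (hc : c ∈ₘ X) (hd : d ∈ₘ X)
    (hab : Rel R a b) (hbc : Rel R b c) (hcd : Rel R c d) :
    ∃ s, s ∈ₘ P ∧ ∀ z, z ∈ₘ s ↔ z = a ∨ z = b ∨ z = c ∨ z = d := by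
  obtain ⟨s, hs, k⟩ := h.sep X (fun z => z = a ∨ z = b ∨ z = c ∨ z = d)
  have k' : ∀ z, z ∈ₘ s ↔ z = a ∨ z = b ∨ z = c ∨ z = d := by
    refine fun z => (k z).trans (and_iff_right_of_imp ?_)
    rintro (rfl | rfl | rfl | rfl) <;> assumption
  refine ⟨s, (hP.2 s).2 ⟨hs, fun z hz => ((k z).1 hz).1,
    (h.exists_bij_numeral_iff 4 s).2 ⟨![a, b, c, d], ?_, fun z => ?_⟩⟩, k'⟩
  · have ne : ∀ {x y}, Rel R x y → x ≠ y := fun {x y} k e => hR.2.1 x (by rw [← e] at k; exact k)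
    have hac := hR.2.2.1 _ _ _ hab hbc
    have hbd := hR.2.2.1 _ _ _ hbc hcd
    have had := hR.2.2.1 _ _ _ hac hcd
    have n1 := ne hab
    have n2 := ne hbc
    have n3 := ne hcd
    have n4 := ne hac
    have n5 := ne hbd
    have n6 := ne had
    intro i j hij
    fin_cases i <;> fin_cases j <;> simp_all [eq_comm]
  · rw [k' z]
    simp [Fin.exists_fin_succ, eq_comm]

/-- The enumeration by `Fin 4` is an external finite set, which can be sorted in the external linear
order induced by `R`. -/
theorem increasing_of_mem {X P R s : M} (hP : IsSubsetsOfSize 4 X P) (hR : IsLinearOrdering R X)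
    (hs : s ∈ₘ P) : ∃ a b c d, (∀ z, z ∈ₘ s ↔ z = a ∨ z = b ∨ z = c ∨ z = d) ∧
      Rel R a b ∧ Rel R b c ∧ Rel R c d := by
  obtain ⟨-, hsX, hbij⟩ := (hP.2 s).1 hs
  obtain ⟨e, einj, he⟩ := (h.exists_bij_numeral_iff 4 s).1 hbij
  let _ := hR.linearOrder
  let e' : Fin 4 → {x // x ∈ₘ X} := fun i => ⟨e i, hsX _ ((he _).2 ⟨i, rfl⟩)⟩
  have e'inj : Function.Injective e' := fun i j hij => einj (congrArg Subtype.val hij)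
  let t := Finset.univ.image e'
  have ht : t.card = 4 := by simp [t, Finset.card_image_of_injective _ e'inj]
  let g := t.orderEmbOfFin ht
  refine ⟨(g 0).1, (g 1).1, (g 2).1, (g 3).1, fun z => ?_, g.lt_iff_lt.2 (by decide),
    g.lt_iff_lt.2 (by decide), g.lt_iff_lt.2 (by decide)⟩
  have hg : (∃ i, (g i).1 = z) ↔ z ∈ₘ s := by
    rw [he z]
    constructor
    · rintro ⟨i, rfl⟩
      have := t.orderEmbOfFin_mem ht i
      obtain ⟨j, -, hj⟩ := Finset.mem_image.1 this
      exact ⟨j, congrArg Subtype.val hj⟩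
    · rintro ⟨j, rfl⟩
      have : e' j ∈ Set.range g := by
        rw [Finset.range_orderEmbOfFin]
        exact Finset.mem_coe.2 (Finset.mem_image_of_mem _ (Finset.mem_univ j))
      obtain ⟨i, hi⟩ := this
      exact ⟨i, congrArg Subtype.val hi⟩
  rw [← hg]
  simp [Fin.exists_fin_succ, eq_comm]

/-- Ramsey's theorem for definable properties of increasing quadruples. -/
theorem exists_homOn_of_rt {n : ℕ} (hn : 2 ≤ n) (hRT : RT M 4 n) {X R : M} (hXs : IsSet X)
    (hX : ¬ IsFinite X) (hR : IsLinearOrdering R X) (φ : M → M → M → M → Prop) (hφ : Def4 φ) :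
    ∃ Y, IsSet Y ∧ Sub Y X ∧ ¬ IsFinite Y ∧ HomOn (Rel R) Y φ := by
  obtain ⟨P, hP⟩ := h.exists_subsetsOfSize 4 X
  obtain ⟨k, hk⟩ := h.exists_numeral (M := M) n
  obtain ⟨n0, h0⟩ := h.exists_numeral (M := M) 0
  obtain ⟨n1, h1⟩ := h.exists_numeral (M := M) 1
  have n01 : n1 ≠ n0 := by
    rintro rfl
    exact absurd (h.numeral_inj h0 h1) (by decide)
  -- The color of a 4-set is 1 or 0 according to whether `φ` holds of its increasing enumeration;
  -- this is well defined because that enumeration is unique.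
  obtain ⟨f, hf, hrel⟩ := h.exists_relation P k (fun s e => ∃ a b c d,
    (∀ z, z ∈ₘ s ↔ z = a ∨ z = b ∨ z = c ∨ z = d) ∧ Rel R a b ∧ Rel R b c ∧ Rel R c d ∧
      ((φ a b c d ∧ e = n1) ∨ (¬ φ a b c d ∧ e = n0)))
  have hk0 : n0 ∈ₘ k := (h.mem_numeral hk n0).2 ⟨0, by omega, h0⟩
  have hk1 : n1 ∈ₘ k := (h.mem_numeral hk n1).2 ⟨1, by omega, h1⟩
  have value : ∀ {s a b c d e}, (∀ z, z ∈ₘ s ↔ z = a ∨ z = b ∨ z = c ∨ z = d) → Rel R a b →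
      Rel R b c → Rel R c d → Rel f s e → (φ a b c d ∧ e = n1) ∨ (¬ φ a b c d ∧ e = n0) := by
    intro s a b c d e hs hab hbc hcd hse
    obtain ⟨-, -, a', b', c', d', hs', hab', hbc', hcd', k⟩ := (hrel s e).1 hse
    let _ := hR.linearOrder
    obtain ⟨ha, hb⟩ := h.rel_mem hR.1 hab
    obtain ⟨hc, hd⟩ := h.rel_mem hR.1 hcd
    obtain ⟨ha', hb'⟩ := h.rel_mem hR.1 hab'
    obtain ⟨hc', hd'⟩ := h.rel_mem hR.1 hcd'
    obtain ⟨e1, e2, e3, e4⟩ := increasing_quadruple_unique (α := {x // x ∈ₘ X})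
      (a := ⟨a, ha⟩) (b := ⟨b, hb⟩) (c := ⟨c, hc⟩) (d := ⟨d, hd⟩)
      (a' := ⟨a', ha'⟩) (b' := ⟨b', hb'⟩) (c' := ⟨c', hc'⟩) (d' := ⟨d', hd'⟩)
      hab hbc hcd hab' hbc' hcd' (fun z => by
        simpa only [Subtype.ext_iff] using (hs z.1).symm.trans (hs' z.1))
    simp only [Subtype.mk.injEq] at e1 e2 e3 e4
    subst e1 e2 e3 e4
    exact k
  have hfun : IsFun f P k := by
    refine ⟨hf, fun s hs => ?_⟩
    obtain ⟨a, b, c, d, hz, hab, hbc, hcd⟩ := h.increasing_of_mem hP hR hs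
    by_cases hφ' : φ a b c d
    · refine ⟨n1, (hrel s n1).2 ⟨hs, hk1, a, b, c, d, hz, hab, hbc, hcd, Or.inl ⟨hφ', rfl⟩⟩,
        fun e he => ?_⟩
      rcases value hz hab hbc hcd he with k | k
      exacts [k.2, (k.1 hφ').elim]
    · refine ⟨n0, (hrel s n0).2 ⟨hs, hk0, a, b, c, d, hz, hab, hbc, hcd, Or.inr ⟨hφ', rfl⟩⟩,
        fun e he => ?_⟩
      rcases value hz hab hbc hcd he with k | k
      exacts [(hφ' k.1).elim, k.2]
  obtain ⟨Y, hYs, hYX, hY, hom⟩ := hRT X P k f hXs hX hP hk hfun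
  refine ⟨Y, hYs, hYX, hY, ?_⟩
  intro a b c d a' b' c' d' ha hb hc hd ha' hb' hc' hd' hab hbc hcd hab' hbc' hcd' H
  by_contra H'
  obtain ⟨s, hs, hsz⟩ := h.exists_quadruple hP hR (hYX _ ha) (hYX _ hb) (hYX _ hc) (hYX _ hd)
    hab hbc hcd
  obtain ⟨t, ht, htz⟩ := h.exists_quadruple hP hR (hYX _ ha') (hYX _ hb') (hYX _ hc') (hYX _ hd')
    hab' hbc' hcd'
  have k1 := (hrel s n1).2 ⟨hs, hk1, a, b, c, d, hsz, hab, hbc, hcd, Or.inl ⟨H, rfl⟩⟩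
  have k0 := (hrel t n0).2 ⟨ht, hk0, a', b', c', d', htz, hab', hbc', hcd', Or.inr ⟨H', rfl⟩⟩
  refine n01 (hom s t n1 n0 hs ht (fun z hz => ?_) (fun z hz => ?_) k1 k0)
  · rcases (hsz z).1 hz with rfl | rfl | rfl | rfl <;> assumption
  · rcases (htz z).1 hz with rfl | rfl | rfl | rfl <;> assumption

/-- Each pattern is a yes-or-no question about increasing quadruples, so two of the n available
colors are enough, used six times. -/
theorem crt_of_op_of_rt {n : ℕ} (hn : 2 ≤ n) (hOP : OP M) (hRT : RT M 4 n) : CRT M := by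
  intro X P C f hXs hX hP _ hf
  obtain ⟨R, hR⟩ := hOP X hXs
  obtain ⟨Y, ⟨hYs, hYX, hY⟩, -, pat⟩ := exists_patternOn
    (fun Y => IsSet Y ∧ Sub Y X ∧ ¬ IsFinite Y) (Rel R) (fun φ hφ Y hY => by
      obtain ⟨hYs, hYX, hY⟩ := hY
      obtain ⟨S, hS, hSrel⟩ := h.exists_restrict hR hYX
      obtain ⟨Z, hZs, hZY, hZ, hom⟩ := h.exists_homOn_of_rt hn hRT hYs hY hS φ hφ
      refine ⟨Z, ⟨hZs, fun z hz => hYX z (hZY z hz), hZ⟩, hZY, ?_⟩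
      intro a b c d a' b' c' d' ha hb hc hd ha' hb' hc' hd' hab hbc hcd hab' hbc' hcd'
      have lift : ∀ {x y}, x ∈ₘ Z → y ∈ₘ Z → Rel R x y → Rel S x y := fun hx hy k =>
        (hSrel _ _).2 ⟨hZY _ hx, hZY _ hy, k⟩
      exact hom a b c d a' b' c' d' ha hb hc hd ha' hb' hc' hd' (lift ha hb hab) (lift hb hc hbc)
        (lift hc hd hcd) (lift ha' hb' hab') (lift hb' hc' hbc') (lift hc' hd' hcd'))
    (SameColor f) (by intro _ _ _ _ _ _ _ _ _; infer_instance) ⟨hXs, fun _ hz => hz, hX⟩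
  obtain ⟨S, hS, hSrel⟩ := h.exists_restrict hR hYX
  have transfer : ∀ {φ}, HomOn (Rel R) Y φ → HomOn (Rel S) Y φ := by
    intro φ k a b c d a' b' c' d' ha hb hc hd ha' hb' hc' hd' hab hbc hcd hab' hbc' hcd'
    have lift : ∀ {x y}, Rel S x y → Rel R x y := fun k => ((hSrel _ _).1 k).2.2
    exact k a b c d a' b' c' d' ha hb hc hd ha' hb' hc' hd' (lift hab) (lift hbc) (lift hcd)
      (lift hab') (lift hbc') (lift hcd')
  exact h.hasCanonicalSubset_of_patternOn hP hf hYs hYX hY hS ⟨transfer pat.left,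
    transfer pat.right, transfer pat.mid, transfer pat.disj, transfer pat.cross, transfer pat.nest⟩

end IsZFA
end SetStructure

/-! ### The universe over the atoms and the action of permutations on it -/

namespace PreASet
variable {A : Type v}

theorem act_act (g k : Equiv.Perm A) : ∀ x : PreASet A, act g (act k x) = act (g * k) x
  | .atom _ => rfl
  | .mk ι x => congrArg (PreASet.mk ι) (funext fun i => act_act g k (x i))

theorem act_one : ∀ x : PreASet A, act 1 x = x
  | .atom _ => rfl
  | .mk ι x => congrArg (PreASet.mk ι) (funext fun i => act_one (x i))

theorem mem_act (g : Equiv.Perm A) (x : PreASet A) : ∀ y, Mem x y → Mem (act g x) (act g y)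
  | .mk _ _, ⟨i, hi⟩ => ⟨i, act_congr g hi⟩

theorem isAtom_act (g : Equiv.Perm A) : ∀ x : PreASet A, IsAtom (act g x) ↔ IsAtom x
  | .atom _ => Iff.rfl
  | .mk _ _ => Iff.rfl

end PreASet

namespace ASet
open SetStructure
variable {A : Type v}

theorem act_act (g k : Equiv.Perm A) (x : ASet A) : act g (act k x) = act (g * k) x := by
  induction x using Quotient.ind
  exact congrArg _ (PreASet.act_act g k _)

theorem act_one (x : ASet A) : act 1 x = x := by
  induction x using Quotient.ind
  exact congrArg _ (PreASet.act_one _)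

theorem act_inv_act (g : Equiv.Perm A) (x : ASet A) : act g⁻¹ (act g x) = x := by
  rw [act_act, inv_mul_cancel, act_one]

theorem mem_act (g : Equiv.Perm A) (x y : ASet A) : act g x ∈ₘ act g y ↔ x ∈ₘ y := by
  have key : ∀ (g : Equiv.Perm A) (x y : ASet A), x ∈ₘ y → act g x ∈ₘ act g y := by
    intro g x y
    induction x using Quotient.ind
    induction y using Quotient.ind
    exact PreASet.mem_act g _ _
  exact ⟨fun k => by simpa only [act_inv_act] using key g⁻¹ _ _ k, key g x y⟩

theorem isAtom_act (g : Equiv.Perm A) (x : ASet A) : isAtom (act g x) ↔ isAtom x := by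
  induction x using Quotient.ind
  exact PreASet.isAtom_act g _

/-- An atom, as an element of the universe. -/
def atom (a : A) : ASet A := Quotient.mk _ (.atom a)

/-- The set of the values of a family. -/
noncomputable def range {ι : Type v} (x : ι → ASet A) : ASet A :=
  Quotient.mk _ (.mk ι fun i => (x i).out)

theorem mem_range {ι : Type v} (x : ι → ASet A) (z : ASet A) : z ∈ₘ range x ↔ ∃ i, z = x i := by
  induction z using Quotient.ind with | _ z
  refine exists_congr fun i => ?_
  refine Iff.trans ?_ (Quotient.out_equiv_out (s := PreASet.setoid A)
    (x := Quotient.mk _ z) (y := x i))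
  have e : PreASet.Equiv (Quotient.mk (PreASet.setoid A) z).out z :=
    Quotient.mk_out (s := PreASet.setoid A) z
  exact ⟨fun k => e.trans k, fun k => e.symm.trans k⟩

theorem not_isAtom_range {ι : Type v} (x : ι → ASet A) : ¬ isAtom (range x) := fun k => k

theorem isAtom_iff (x : ASet A) : isAtom x ↔ ∃ a, x = atom a := by
  constructor
  · induction x using Quotient.ind with | _ x
    cases x with
    | atom a => exact fun _ => ⟨a, rfl⟩
    | mk ι x => exact fun k => k.elim
  · rintro ⟨a, rfl⟩
    exact trivial

theorem atom_injective : Function.Injective (atom : A → ASet A) := fun a b k => by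
  have : PreASet.Equiv (.atom a) (.atom b) := Quotient.exact (s := PreASet.setoid A) k
  rwa [PreASet.Equiv] at this

theorem act_atom (g : Equiv.Perm A) (a : A) : act g (atom a) = atom (g a) := rfl

theorem not_mem_atom (a x : ASet A) (ha : isAtom a) : ¬ x ∈ₘ a := by
  obtain ⟨a, rfl⟩ := (isAtom_iff a).1 ha
  induction x using Quotient.ind
  exact fun k => k

theorem exists_members (x : ASet A) : ∃ (ι : Type v) (y : ι → ASet A), ∀ z, z ∈ₘ x ↔ ∃ i, z = y i := by
  induction x using Quotient.ind with | _ x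
  cases x with
  | atom a => exact ⟨PEmpty, PEmpty.elim, fun z => iff_of_false (not_mem_atom _ _ trivial) (by simp)⟩
  | mk ι x =>
    refine ⟨ι, fun i => Quotient.mk _ (x i), fun z => ?_⟩
    induction z using Quotient.ind with | _ z
    exact exists_congr fun i => (Quotient.eq (r := PreASet.setoid A)).symm

/-- Smallness in the universe of `A` separates sets from proper classes: exactly the small classes
can be collected by `range`. -/
instance small_members (x : ASet A) : Small.{v} {z | z ∈ₘ x} := by
  obtain ⟨ι, y, k⟩ := exists_members x
  have : {z | z ∈ₘ x} = Set.range y := by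
    ext z
    exact (k z).trans (exists_congr fun i => eq_comm)
  rw [this]
  infer_instance

theorem ext {x y : ASet A} (hx : ¬ isAtom x) (hy : ¬ isAtom y) (k : ∀ z, z ∈ₘ x ↔ z ∈ₘ y) :
    x = y := by
  induction x using Quotient.ind with | _ x
  induction y using Quotient.ind with | _ y
  cases x with
  | atom a => exact (hx trivial).elim
  | mk ι x =>
    cases y with
    | atom a => exact (hy trivial).elim
    | mk ι' y =>
      refine Quotient.sound (s := PreASet.setoid A) (show PreASet.Equiv _ _ from ?_)
      rw [PreASet.Equiv]
      constructor
      · intro i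
        exact (k (Quotient.mk _ (x i))).1 ⟨i, PreASet.Equiv.refl _⟩
      · intro j
        obtain ⟨i, hi⟩ := (k (Quotient.mk _ (y j))).2 ⟨j, PreASet.Equiv.refl _⟩
        exact ⟨i, hi.symm⟩

theorem mem_wf : WellFounded (fun x y : ASet A => x ∈ₘ y) := by
  refine ⟨fun x => ?_⟩
  induction x using Quotient.ind with | _ x
  induction x with
  | atom a => exact ⟨_, fun y hy => (not_mem_atom _ y trivial hy).elim⟩
  | mk ι x ih =>
    refine ⟨_, fun y hy => ?_⟩
    induction y using Quotient.ind with | _ y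
    obtain ⟨i, hi⟩ := hy
    rw [show Quotient.mk (PreASet.setoid A) y = Quotient.mk _ (x i) from Quotient.sound hi]
    exact ih i

variable [LinearOrder A]

theorem isHereditarilySymmetric_iff (x : ASet A) : IsHereditarilySymmetric x ↔
    (∃ E : Finset A, IsSupport E x) ∧ ∀ y, y ∈ₘ x → IsHereditarilySymmetric y := by
  constructor
  · exact fun k => ⟨k x .refl, fun y hy t ht => k t (ht.tail hy)⟩
  · rintro ⟨hE, k⟩ t ht
    rcases Relation.ReflTransGen.cases_tail ht with rfl | ⟨y, hty, hy⟩
    exacts [hE, k y hy t hty]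

theorem toEquiv_mul (g k : A ≃o A) : g.toEquiv * k.toEquiv = (k.trans g).toEquiv := rfl

/-- An automorphism fixing g(E) pointwise becomes, after conjugation by g, one fixing E pointwise.
-/
theorem IsSupport.act {E : Finset A} {x : ASet A} (hE : IsSupport E x) (g : A ≃o A) :
    IsSupport (E.image g) (act g.toEquiv x) := by
  intro k hk
  have := hE ((g.trans k).trans g.symm) fun a ha => by
    simp [hk (g a) (Finset.mem_image_of_mem _ ha)]
  rw [← toEquiv_mul, ← toEquiv_mul, ← act_act, ← act_act] at this
  have := congrArg (ASet.act g.toEquiv) this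
  rwa [act_act, toEquiv_mul, show g.symm.trans g = OrderIso.refl A by ext; simp,
    show (OrderIso.refl A).toEquiv = 1 from rfl, act_one] at this

theorem IsHereditarilySymmetric.act {x : ASet A} (hx : IsHereditarilySymmetric x) (g : A ≃o A) :
    IsHereditarilySymmetric (act g.toEquiv x) := by
  induction x using mem_wf.induction with | _ x ih
  obtain ⟨⟨E, hE⟩, k⟩ := (isHereditarilySymmetric_iff x).1 hx
  refine (isHereditarilySymmetric_iff _).2 ⟨⟨_, hE.act g⟩, fun y hy => ?_⟩
  have e : ASet.act g.toEquiv (ASet.act g.toEquiv⁻¹ y) = y := by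
    rw [act_act, mul_inv_cancel, act_one]
  rw [← e] at hy ⊢
  rw [mem_act] at hy
  exact ih _ hy (k _ hy)

end ASet

/-! ### The permutation model satisfies ZFA -/

namespace MostowskiModel
open SetStructure
variable {A : Type v} [LinearOrder A]

/-- The action of the order automorphisms on the model. -/
def act (g : A ≃o A) (x : MostowskiModel A) : MostowskiModel A :=
  ⟨ASet.act g.toEquiv x.1, x.2.act g⟩

/-- The automorphism `g` fixes `E` pointwise. -/
def Fixes (E : Finset A) (g : A ≃o A) : Prop := ∀ a ∈ E, g a = a

theorem Fixes.mono {E F : Finset A} {g : A ≃o A} (hg : Fixes F g) (hEF : E ⊆ F) : Fixes E g :=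
  fun a ha => hg a (hEF ha)

theorem Fixes.symm {E : Finset A} {g : A ≃o A} (hg : Fixes E g) : Fixes E g.symm := fun a ha => by
  rw [OrderIso.symm_apply_eq, hg a ha]

theorem Fixes.trans {E : Finset A} {g k : A ≃o A} (hg : Fixes E g) (hk : Fixes E k) :
    Fixes E (g.trans k) := fun a ha => by
  rw [OrderIso.trans_apply, hg a ha, hk a ha]

theorem act_act (g k : A ≃o A) (x : MostowskiModel A) : act g (act k x) = act (k.trans g) x :=
  Subtype.ext (ASet.act_act _ _ _)

theorem act_symm_act (g : A ≃o A) (x : MostowskiModel A) : act g.symm (act g x) = x :=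
  Subtype.ext (ASet.act_inv_act _ _)

theorem act_act_symm (g : A ≃o A) (x : MostowskiModel A) : act g (act g.symm x) = x :=
  act_symm_act g.symm x

/-- The action of an order automorphism, as a permutation of the model. -/
def actEquiv (g : A ≃o A) : MostowskiModel A ≃ MostowskiModel A :=
  ⟨act g, act g.symm, act_symm_act g, act_act_symm g⟩

theorem act_surjective (g : A ≃o A) : Function.Surjective (act g) := (actEquiv g).surjective

theorem act_inj (g : A ≃o A) {x y : MostowskiModel A} : act g x = act g y ↔ x = y :=
  (actEquiv g).injective.eq_iff

theorem mem_act (g : A ≃o A) {x y : MostowskiModel A} : act g x ∈ₘ act g y ↔ x ∈ₘ y :=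
  ASet.mem_act _ _ _

theorem isAtom_act (g : A ≃o A) (x : MostowskiModel A) : isAtom (act g x) ↔ isAtom x :=
  ASet.isAtom_act _ _

/-- The action of an order automorphism, as an automorphism of the model. -/
def actIso (g : A ≃o A) : lang.Equiv (MostowskiModel A) (MostowskiModel A) where
  toEquiv := actEquiv g
  map_fun' f := f.elim
  map_rel' r x := by
    cases r with
    | mem => exact mem_act g
    | atom => exact isAtom_act g _

theorem exists_support (x : MostowskiModel A) : ∃ E : Finset A, ∀ g, Fixes E g → act g x = x := by
  obtain ⟨E, hE⟩ := x.2 x.1 .refl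
  exact ⟨E, fun g hg => Subtype.ext (hE g hg)⟩

/-- A formula has finitely many parameters, and the union of their supports is finite. An
automorphism fixing it acts as an automorphism of the model that fixes all parameters, hence
preserves truth. This yields Separation and Replacement. -/
theorem exists_invariant_of_definable {n : ℕ} {S : Set (Fin n → MostowskiModel A)}
    (hS : (Set.univ : Set (MostowskiModel A)).Definable lang S) :
    ∃ E : Finset A, ∀ g, Fixes E g → ∀ w, w ∈ S → act g ∘ w ∈ S := by
  classical
  obtain ⟨P, -, hP⟩ := Set.definable_iff_finitely_definable.1 hS
  obtain ⟨φ, rfl⟩ := Set.definable_iff_exists_formula_sum.1 hP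
  choose E hE using exists_support (A := A)
  refine ⟨P.biUnion E, fun g hg w hw => ?_⟩
  have := (StrongHomClass.realize_formula (actIso g) φ
    (v := Sum.elim (fun p : (P : Set (MostowskiModel A)) => (p : MostowskiModel A)) w)).2 hw
  have e : Sum.elim (fun p : (P : Set (MostowskiModel A)) => (p : MostowskiModel A)) (act g ∘ w) =
      actIso g ∘ Sum.elim (fun p : (P : Set (MostowskiModel A)) => (p : MostowskiModel A)) w := by
    funext i
    rcases i with p | i
    · exact (hE p.1 g (hg.mono (Finset.subset_biUnion_of_mem E p.2))).symm
    · rfl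
  rw [← e] at this
  exact this

instance small_members (x : MostowskiModel A) : Small.{v} {z | z ∈ₘ x} :=
  small_of_injective (β := {z : ASet A | z ∈ₘ x.1}) (f := fun z => ⟨z.1.1, z.2⟩)
    fun _ _ k => Subtype.ext (Subtype.ext (congrArg (fun z => z.1) k))

theorem ext {x y : MostowskiModel A} (hx : IsSet x) (hy : IsSet y) (k : ∀ z, z ∈ₘ x ↔ z ∈ₘ y) :
    x = y := by
  refine Subtype.ext (ASet.ext hx hy fun z => ⟨fun hz => ?_, fun hz => ?_⟩)
  · exact (k ⟨z, ((ASet.isHereditarilySymmetric_iff _).1 x.2).2 z hz⟩).1 hz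
  · exact (k ⟨z, ((ASet.isHereditarilySymmetric_iff _).1 y.2).2 z hz⟩).2 hz

/-- A small class that is invariant under the automorphisms fixing a finite set is a set. -/
theorem exists_set (S : Set (MostowskiModel A)) [Small.{v} S] (E : Finset A)
    (hE : ∀ g, Fixes E g → ∀ x, x ∈ S → act g x ∈ S) :
    ∃ y : MostowskiModel A, IsSet y ∧ ∀ z, z ∈ₘ y ↔ z ∈ S := by
  let y : ASet A := ASet.range fun i : Shrink.{v} S => ((equivShrink S).symm i).1.1
  have hy : ∀ z, z ∈ₘ y ↔ ∃ s ∈ S, z = s.1 := by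
    refine fun z => (ASet.mem_range _ z).trans ⟨?_, ?_⟩
    · rintro ⟨i, rfl⟩
      exact ⟨_, ((equivShrink S).symm i).2, rfl⟩
    · rintro ⟨s, hs, rfl⟩
      exact ⟨equivShrink S ⟨s, hs⟩, by simp⟩
  have sym : ASet.IsHereditarilySymmetric y := by
    refine (ASet.isHereditarilySymmetric_iff y).2 ⟨⟨E, fun g hg => ?_⟩, fun z hz => ?_⟩
    · refine ASet.ext ((ASet.isAtom_act _ _).not.2 (ASet.not_isAtom_range _))
        (ASet.not_isAtom_range _) fun z => ?_
      rw [hy z]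
      constructor
      · intro hz
        have e : ASet.act g.toEquiv (ASet.act g.toEquiv⁻¹ z) = z := by
          rw [ASet.act_act, mul_inv_cancel, ASet.act_one]
        rw [← e, ASet.mem_act, hy] at hz
        obtain ⟨s, hs, k⟩ := hz
        exact ⟨act g s, hE g hg s hs, e.symm.trans (congrArg (ASet.act g.toEquiv) k)⟩
      · rintro ⟨s, hs, rfl⟩
        have e := congrArg Subtype.val (act_act_symm g s)
        rw [← e]
        exact (ASet.mem_act _ _ _).2 ((hy _).2 ⟨_, hE _ (Fixes.symm hg) s hs, rfl⟩)
    · obtain ⟨s, -, rfl⟩ := (hy z).1 hz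
      exact s.2
  refine ⟨⟨y, sym⟩, ASet.not_isAtom_range _, fun z => (hy z.1).trans ⟨?_, fun hz => ⟨z, hz, rfl⟩⟩⟩
  rintro ⟨s, hs, e⟩
  rwa [show z = s from Subtype.ext e]

/-! ### Invariance of the basic notions -/

theorem isSet_act (g : A ≃o A) (x : MostowskiModel A) : IsSet (act g x) ↔ IsSet x :=
  (isAtom_act g x).not

theorem sub_act (g : A ≃o A) (x y : MostowskiModel A) : Sub (act g x) (act g y) ↔ Sub x y := by
  unfold SetStructure.Sub
  rw [(act_surjective g).forall]
  simp only [mem_act]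

theorem isEmptySet_act (g : A ≃o A) (x : MostowskiModel A) :
    IsEmptySet (act g x) ↔ IsEmptySet x := by
  unfold IsEmptySet
  rw [(act_surjective g).forall]
  simp only [mem_act, isSet_act]

theorem isUPair_act (g : A ≃o A) (x a b : MostowskiModel A) :
    IsUPair (act g x) (act g a) (act g b) ↔ IsUPair x a b := by
  unfold IsUPair
  rw [(act_surjective g).forall]
  simp only [mem_act, isSet_act, act_inj]

theorem isPair_act (g : A ≃o A) (x a b : MostowskiModel A) :
    IsPair (act g x) (act g a) (act g b) ↔ IsPair x a b := by
  unfold IsPair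
  rw [(act_surjective g).forall]
  simp only [mem_act, isSet_act, isUPair_act]

theorem isSucc_act (g : A ≃o A) (x a : MostowskiModel A) :
    IsSucc (act g x) (act g a) ↔ IsSucc x a := by
  unfold IsSucc
  rw [(act_surjective g).forall]
  simp only [mem_act, isSet_act, act_inj]

theorem isNumeral_act (g : A ≃o A) (n : ℕ) (x : MostowskiModel A) :
    IsNumeral n (act g x) ↔ IsNumeral n x := by
  induction n generalizing x with
  | zero => exact isEmptySet_act g x
  | succ n ih =>
    unfold IsNumeral
    rw [(act_surjective g).exists]
    simp only [ih, isSucc_act]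

theorem rel_act (g : A ≃o A) (r a b : MostowskiModel A) :
    Rel (act g r) (act g a) (act g b) ↔ Rel r a b := by
  unfold SetStructure.Rel
  rw [(act_surjective g).exists]
  simp only [mem_act, isPair_act]

theorem sameColor_act (g : A ≃o A) (f a b c d : MostowskiModel A) :
    SameColor (act g f) (act g a) (act g b) (act g c) (act g d) ↔ SameColor f a b c d := by
  unfold SameColor
  refine (act_surjective g).exists.trans (exists_congr fun s => ?_)
  refine (act_surjective g).exists.trans (exists_congr fun t => ?_)
  refine (act_surjective g).exists.trans (exists_congr fun e => ?_)
  simp only [isUPair_act, rel_act]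

theorem isNumeral_unique {n : ℕ} {x y : MostowskiModel A} (hx : IsNumeral n x)
    (hy : IsNumeral n y) : x = y := by
  induction n generalizing x y with
  | zero => exact ext hx.1 hy.1 fun z => iff_of_false (hx.2 z) (hy.2 z)
  | succ n ih =>
    obtain ⟨x', hx', hx⟩ := hx
    obtain ⟨y', hy', hy⟩ := hy
    obtain rfl := ih hx' hy'
    exact ext hx.1 hy.1 fun z => (hx.2 z).trans (hy.2 z).symm

/-- The set of the numerals. -/
theorem exists_numerals :
    ∃ I : MostowskiModel A, IsSet I ∧ ∀ z, z ∈ₘ I ↔ ∃ n, IsNumeral n z := by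
  have : Small.{v} {z : MostowskiModel A | ∃ n, IsNumeral n z} := by
    have e : {z : MostowskiModel A | ∃ n, IsNumeral n z} = ⋃ n : ℕ, {z | IsNumeral n z} := by
      ext z
      simp
    rw [e]
    have (n : ℕ) : Small.{v} {z : MostowskiModel A | IsNumeral n z} := by
      have : Subsingleton {z : MostowskiModel A | IsNumeral n z} :=
        ⟨fun x y => Subtype.ext (isNumeral_unique x.2 y.2)⟩
      infer_instance
    infer_instance
  exact exists_set {z | ∃ n, IsNumeral n z} ∅ fun g _ x ⟨n, hn⟩ => ⟨n, (isNumeral_act g n x).2 hn⟩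

theorem numerals_inductive {I : MostowskiModel A} (hI : ∀ z, z ∈ₘ I ↔ ∃ n, IsNumeral n z) :
    IsInductive I := by
  constructor
  · obtain ⟨e, he, k⟩ := exists_set (∅ : Set (MostowskiModel A)) ∅ (by simp)
    exact ⟨e, ⟨he, fun z hz => (k z).1 hz⟩, (hI e).2 ⟨0, he, fun z hz => (k z).1 hz⟩⟩
  · intro x hx
    obtain ⟨n, hn⟩ := (hI x).1 hx
    obtain ⟨E, hE⟩ := exists_support x
    obtain ⟨y, hy, k⟩ := exists_set ({z | z ∈ₘ x} ∪ {x}) E fun g hg z hz => by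
      rcases hz with hz | rfl
      · exact Or.inl ((hE g hg) ▸ (mem_act g).2 hz)
      · exact Or.inr (hE g hg)
    have hs : IsSucc y x := ⟨hy, k⟩
    exact ⟨y, hs, (hI y).2 ⟨n + 1, x, hn, hs⟩⟩

/-- The permutation model is a model of ZFA. -/
theorem isZFA : IsZFA (MostowskiModel A) := by
  classical
  refine ⟨fun a x ha => ASet.not_mem_atom _ _ ha, ?_, fun x y => ext, ?_, ?_, ?_, ?_, ?_, ?_, ?_⟩
  · have : Small.{v} {z : MostowskiModel A | isAtom z} := by
      have k : ∀ z : MostowskiModel A, isAtom z → ∃ a, z.1 = ASet.atom a :=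
        fun z hz => (ASet.isAtom_iff z.1).1 hz
      choose a ha using k
      refine small_of_injective (β := A) (f := fun z => a z.1 z.2) fun x y e => ?_
      exact Subtype.ext (Subtype.ext ((ha _ x.2).trans
        ((congrArg ASet.atom e).trans (ha _ y.2).symm)))
    exact exists_set {z | isAtom z} ∅ fun g _ x hx => (isAtom_act g x).2 hx
  · intro a b
    obtain ⟨E, hE⟩ := exists_support a
    obtain ⟨F, hF⟩ := exists_support b
    refine exists_set {a, b} (E ∪ F) fun g hg x hx => ?_
    rcases hx with rfl | rfl
    · exact Or.inl (hE g (hg.mono Finset.subset_union_left))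
    · exact Or.inr (hF g (hg.mono Finset.subset_union_right))
  · intro x
    obtain ⟨E, hE⟩ := exists_support x
    have : Small.{v} {z : MostowskiModel A | ∃ w, w ∈ₘ x ∧ z ∈ₘ w} := by
      have e : {z : MostowskiModel A | ∃ w, w ∈ₘ x ∧ z ∈ₘ w} =
          ⋃ w : {w | w ∈ₘ x}, {z | z ∈ₘ w.1} := by
        ext z
        simp
      rw [e]
      infer_instance
    refine exists_set {z | ∃ w, w ∈ₘ x ∧ z ∈ₘ w} E fun g hg z ⟨w, hw, hz⟩ => ?_
    exact ⟨act g w, hE g hg ▸ (mem_act g).2 hw, (mem_act g).2 hz⟩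
  · intro x
    obtain ⟨E, hE⟩ := exists_support x
    have : Small.{v} {z : MostowskiModel A | IsSet z ∧ Sub z x} := by
      -- A subset of x in the model is determined by its trace on the small type of members of x.
      refine small_of_injective (β := Set {w | w ∈ₘ x}) (f := fun z => {w | w.1 ∈ₘ z.1})
        fun y z e => Subtype.ext (ext y.2.1 z.2.1 fun w => ⟨fun hw => ?_, fun hw => ?_⟩)
      · exact (Set.ext_iff.1 e ⟨w, y.2.2 w hw⟩).1 hw
      · exact (Set.ext_iff.1 e ⟨w, z.2.2 w hw⟩).2 hw
    refine exists_set {z | IsSet z ∧ Sub z x} E fun g hg z hz => ⟨(isSet_act g z).2 hz.1, ?_⟩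
    have := (sub_act g z x).2 hz.2
    rwa [hE g hg] at this
  · obtain ⟨I, hI, k⟩ := exists_numerals (A := A)
    exact ⟨I, hI, numerals_inductive k⟩
  · rintro x ⟨y, hy⟩
    obtain ⟨z, hz, k⟩ := ASet.mem_wf.has_min {z | z ∈ₘ x.1} ⟨y.1, hy⟩
    exact ⟨⟨z, ((ASet.isHereditarilySymmetric_iff _).1 x.2).2 z hz⟩, hz,
      fun w hw hwx => k w.1 hwx hw⟩
  · intro S hS x
    obtain ⟨E, hE⟩ := exists_support x
    obtain ⟨F, hF⟩ := exists_invariant_of_definable hS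
    have : Small.{v} {z | z ∈ₘ x ∧ z ∈ S} :=
      small_subset (s := {z | z ∈ₘ x}) fun z hz => hz.1
    refine exists_set {z | z ∈ₘ x ∧ z ∈ S} (E ∪ F) fun g hg z hz => ⟨?_, ?_⟩
    · exact hE g (hg.mono Finset.subset_union_left) ▸ (mem_act g).2 hz.1
    · exact hF g (hg.mono Finset.subset_union_right) (fun _ => z) hz.2
  · intro F hF x hfun
    obtain ⟨E, hE⟩ := exists_support x
    obtain ⟨E', hE'⟩ := exists_invariant_of_definable hF
    have : Small.{v} {b | ∃ a, a ∈ₘ x ∧ (a, b) ∈ F} := by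
      -- The image is a small union of classes with at most one element each, hence small.
      have e : {b | ∃ a, a ∈ₘ x ∧ (a, b) ∈ F} = ⋃ a : {a | a ∈ₘ x}, {b | (a.1, b) ∈ F} := by
        ext z
        simp
      rw [e]
      have (a : {a | a ∈ₘ x}) : Small.{v} {b | (a.1, b) ∈ F} := by
        have : Subsingleton {b | (a.1, b) ∈ F} :=
          ⟨fun b b' => Subtype.ext (hfun _ _ _ a.2 b.2 b'.2)⟩
        infer_instance
      infer_instance
    refine exists_set {b | ∃ a, a ∈ₘ x ∧ (a, b) ∈ F} (E ∪ E') fun g hg b ⟨a, ha, hab⟩ =>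
      ⟨act g a, ?_, ?_⟩
    · exact hE g (hg.mono Finset.subset_union_left) ▸ (mem_act g).2 ha
    · exact hE' g (hg.mono Finset.subset_union_right) ![a, b] hab

end MostowskiModel

/-! ### Homogeneity of the order of the atoms -/

/-- A finite partial isomorphism of a countable dense linear order without endpoints extends to an
automorphism. -/
theorem exists_orderIso_extending {A : Type*} [LinearOrder A] [Countable A] [DenselyOrdered A]
    [NoMinOrder A] [NoMaxOrder A] [Nonempty A] (s : Finset (A × A))
    (hs : ∀ p ∈ s, ∀ q ∈ s, cmp p.1 q.1 = cmp p.2 q.2) : ∃ g : A ≃o A, ∀ p ∈ s, g p.1 = p.2 := by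
  cases nonempty_encodable A
  let toCofinal : A ⊕ A → Order.Cofinal (Order.PartialIso A A) := fun p =>
    Sum.recOn p (Order.PartialIso.definedAtLeft A) (Order.PartialIso.definedAtRight A)
  -- Back and forth, started at `s`: an ideal of finite partial isomorphisms that contains `s` and
  -- defines every point on both sides.
  let I : Order.Ideal (Order.PartialIso A A) := Order.idealOfCofinals ⟨s, hs⟩ toCofinal
  let F a := Order.PartialIso.funOfIdeal a I
    (Order.cofinal_meets_idealOfCofinals _ toCofinal (Sum.inl a))
  let G b := Order.PartialIso.invOfIdeal b I
    (Order.cofinal_meets_idealOfCofinals _ toCofinal (Sum.inr b))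
  refine ⟨OrderIso.ofCmpEqCmp (fun a => (F a).val) (fun b => (G b).val) fun a b => ?_, ?_⟩
  · rcases (F a).prop with ⟨f, hf, ha⟩
    rcases (G b).prop with ⟨g, hg, hb⟩
    rcases I.directed _ hf _ hg with ⟨m, _, fm, gm⟩
    exact m.prop (a, _) (fm ha) (_, b) (gm hb)
  · intro p hp
    rcases (F p.1).prop with ⟨f, hf, ha⟩
    rcases I.directed _ hf _ (Order.mem_idealOfCofinals ⟨s, hs⟩ toCofinal) with ⟨m, _, fm, gm⟩
    have := m.prop (p.1, _) (fm ha) p (gm hp)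
    rw [cmp_self_eq_eq] at this
    exact (cmp_eq_eq_iff _ _).1 this.symm

namespace MostowskiModel
open SetStructure
variable {A : Type v} [LinearOrder A]

/-- The convex set of the elements that are on the same side of every element of `E` as `a`. -/
def Gap (E : Finset A) (a : A) : Set A := {b | b ∉ E ∧ ∀ e ∈ E, e < b ↔ e < a}

theorem apply_mem_gap {E : Finset A} {a b : A} {g : A ≃o A} (hg : Fixes E g) (hb : b ∈ Gap E a) :
    g b ∈ Gap E a := by
  refine ⟨fun k => ?_, fun e he => ?_⟩
  · have := hg.symm _ k
    rw [OrderIso.symm_apply_apply] at this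
    exact hb.1 (this ▸ k)
  · rw [← hb.2 e he]
    nth_rw 1 [← hg e he]
    exact g.lt_iff_lt

section Homogeneity
variable [DenselyOrdered A] [NoMinOrder A] [NoMaxOrder A] [Nonempty A]

/-- Density and the absence of a maximum give a point above b and below the finitely many elements
of `E` that exceed b. -/
theorem exists_gt_mem_gap {E : Finset A} {a b : A} (hb : b ∈ Gap E a) :
    ∃ c ∈ Gap E a, b < c := by
  classical
  obtain ⟨c, hc, hc'⟩ := Order.exists_between_finsets (insert b {e ∈ E | e < b}) {e ∈ E | b < e}
    (by
      intro x hx y hy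
      have hy := (Finset.mem_filter.1 hy).2
      rcases Finset.mem_insert.1 hx with rfl | hx
      exacts [hy, (Finset.mem_filter.1 hx).2.trans hy])
  have hbc := hc b (Finset.mem_insert_self _ _)
  have above : ∀ e ∈ E, ¬ e < b → c < e := fun e he k =>
    hc' e (Finset.mem_filter.2 ⟨he, lt_of_le_of_ne (not_lt.1 k) fun k' => hb.1 (k' ▸ he)⟩)
  refine ⟨c, ⟨fun hcE => ?_, fun e he => ?_⟩, hbc⟩
  · exact lt_irrefl c (above c hcE hbc.not_gt)
  · rw [← hb.2 e he]
    exact ⟨fun k => by_contra fun k' => lt_asymm k (above e he k'), fun k => k.trans hbc⟩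

theorem infinite_gap {E : Finset A} {a : A} (ha : a ∉ E) : Infinite (Gap E a) := by
  have : Nonempty (Gap E a) := ⟨⟨a, ha, fun _ _ => Iff.rfl⟩⟩
  have : NoMaxOrder (Gap E a) := ⟨fun b => by
    obtain ⟨c, hc, hbc⟩ := exists_gt_mem_gap b.2
    exact ⟨⟨c, hc⟩, hbc⟩⟩
  exact NoMaxOrder.infinite

variable [Countable A]

/-- All points of one gap compare in the same way with `E`, so the identity on `E` together with b i
↦ c i is a finite partial isomorphism, and it extends. -/
theorem exists_fixes_of_strictMono {E : Finset A} {a : A} {n : ℕ} {b c : Fin n → A}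
    (hb : StrictMono b) (hc : StrictMono c) (hbE : ∀ i, b i ∈ Gap E a) (hcE : ∀ i, c i ∈ Gap E a) :
    ∃ g, Fixes E g ∧ ∀ i, g (b i) = c i := by
  classical
  have cross : ∀ e ∈ E, ∀ x ∈ Gap E a, ∀ y ∈ Gap E a, cmp e x = cmp e y := by
    intro e he x hx y hy
    have hxy : e < x ↔ e < y := (hx.2 e he).trans (hy.2 e he).symm
    have hex : e ≠ x := fun k => hx.1 (k ▸ he)
    have hey : e ≠ y := fun k => hy.1 (k ▸ he)
    rcases lt_or_gt_of_ne hex with k | k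
    · rw [(cmp_eq_lt_iff _ _).2 k, (cmp_eq_lt_iff _ _).2 (hxy.1 k)]
    · have := (lt_or_gt_of_ne hey).resolve_left fun k' => lt_asymm k (hxy.2 k')
      rw [(cmp_eq_gt_iff _ _).2 k, (cmp_eq_gt_iff _ _).2 this]
  obtain ⟨g, hg⟩ := exists_orderIso_extending
    (E.image (fun e => (e, e)) ∪ Finset.univ.image fun i => (b i, c i)) (by
      intro p hp q hq
      simp only [Finset.mem_union, Finset.mem_image, Finset.mem_univ, true_and] at hp hq
      rcases hp with ⟨e, he, rfl⟩ | ⟨i, rfl⟩ <;> rcases hq with ⟨e', he', rfl⟩ | ⟨j, rfl⟩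
      · rfl
      · exact cross e he _ (hbE j) _ (hcE j)
      · have := cross e' he' _ (hbE i) _ (hcE i)
        rw [← cmp_swap, this, cmp_swap]
      · exact (hb.cmp_map_eq i j).trans (hc.cmp_map_eq i j).symm)
  refine ⟨g, fun e he => hg (e, e) ?_, fun i => hg (b i, c i) ?_⟩
  · exact Finset.mem_union_left _ (Finset.mem_image_of_mem _ he)
  · exact Finset.mem_union_right _ (Finset.mem_image_of_mem (fun i => (b i, c i)) (Finset.mem_univ i))

/-- An atom outside `E` can be moved upwards within its gap by an automorphism fixing `E`. -/
theorem mem_of_forall_fixes {E : Finset A} {a : A} (ha : ∀ g, Fixes E g → g a = a) : a ∈ E := by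
  by_contra haE
  have hag : a ∈ Gap E a := ⟨haE, fun _ _ => Iff.rfl⟩
  obtain ⟨b, hb, hab⟩ := exists_gt_mem_gap hag
  obtain ⟨g, hg, hgab⟩ := exists_fixes_of_strictMono (E := E) (a := a) (b := ![a]) (c := ![b])
    (Subsingleton.strictMono _) (Subsingleton.strictMono _) (by simpa using hag) (by simpa using hb)
  have := hgab 0
  exact hab.ne ((ha g hg).symm.trans this)

end Homogeneity

/-! ### Natural numbers, finiteness and invariant sets in the permutation model -/

theorem isNumeral_of_isNat {n : MostowskiModel A} (hn : IsNat n) : ∃ m, IsNumeral m n := by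
  obtain ⟨I, -, hI⟩ := exists_numerals (A := A)
  exact (hI n).1 (hn I (numerals_inductive hI))

/-- The numerals form a set of the model, so its natural numbers are standard and finiteness in the
model is actual finiteness. -/
theorem finite_of_isFinite {X : MostowskiModel A} (hX : IsFinite X) : Finite {x // x ∈ₘ X} := by
  obtain ⟨n, f, hn, hf⟩ := hX
  obtain ⟨m, hm⟩ := isNumeral_of_isNat hn
  obtain ⟨e, -, he⟩ := (isZFA.exists_bij_numeral_iff m X).1 ⟨n, f, hm, hf⟩
  refine Finite.of_surjective (fun i : Fin m => (⟨e i, (he _).2 ⟨i, rfl⟩⟩ : {x // x ∈ₘ X})) ?_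
  rintro ⟨x, hx⟩
  obtain ⟨i, rfl⟩ := (he x).1 hx
  exact ⟨i, rfl⟩

/-- An atom, as an element of the model. -/
def atom (a : A) : MostowskiModel A := ⟨ASet.atom a, by
  classical
  refine (ASet.isHereditarilySymmetric_iff _).2 ⟨⟨{a}, fun g hg => ?_⟩, fun y hy => ?_⟩
  · exact congrArg ASet.atom (hg a (Finset.mem_singleton_self a))
  · exact (ASet.not_mem_atom _ y trivial hy).elim⟩

theorem isAtom_iff (x : MostowskiModel A) : isAtom x ↔ ∃ a, x = atom a :=
  (ASet.isAtom_iff x.1).trans (exists_congr fun _ => ⟨fun k => Subtype.ext k, congrArg Subtype.val⟩)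

theorem atom_injective : Function.Injective (atom : A → MostowskiModel A) := fun _ _ k =>
  ASet.atom_injective (congrArg Subtype.val k)

theorem act_atom (g : A ≃o A) (a : A) : act g (atom a) = atom (g a) := rfl

/-- A part of a set that is invariant under the automorphisms fixing a finite set is a set. -/
theorem exists_subset_of_invariant (x : MostowskiModel A) (φ : MostowskiModel A → Prop)
    (E : Finset A) (hE : ∀ g, Fixes E g → ∀ z, φ z → φ (act g z)) :
    ∃ y : MostowskiModel A, IsSet y ∧ ∀ z, z ∈ₘ y ↔ z ∈ₘ x ∧ φ z := by
  classical
  obtain ⟨F, hF⟩ := exists_support x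
  have : Small.{v} {z | z ∈ₘ x ∧ φ z} := small_subset (s := {z | z ∈ₘ x}) fun z hz => hz.1
  refine exists_set {z | z ∈ₘ x ∧ φ z} (E ∪ F) fun g hg z hz => ⟨?_, ?_⟩
  · exact hF g (hg.mono Finset.subset_union_right) ▸ (mem_act g).2 hz.1
  · exact hE g (hg.mono Finset.subset_union_left) z hz.2

/-- The relation between two sets given by an invariant relation. -/
theorem exists_relation_of_invariant (x y : MostowskiModel A)
    (φ : MostowskiModel A → MostowskiModel A → Prop) (E : Finset A)
    (hE : ∀ g, Fixes E g → ∀ a b, φ a b → φ (act g a) (act g b)) :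
    ∃ r, IsRelation r x y ∧ ∀ a b, Rel r a b ↔ a ∈ₘ x ∧ b ∈ₘ y ∧ φ a b := by
  have h := isZFA (A := A)
  obtain ⟨p, hp, hprel⟩ := h.exists_relation x y (fun _ _ => True)
  obtain ⟨r, hr, k⟩ := exists_subset_of_invariant p (fun z => ∃ a b, IsPair z a b ∧ φ a b) E
    fun g hg z ⟨a, b, hz, hab⟩ => ⟨act g a, act g b, (isPair_act g z a b).2 hz, hE g hg a b hab⟩
  refine ⟨r, ⟨hr, fun z hz => hp.2 z ((k z).1 hz).1⟩, fun a b => ⟨?_, ?_⟩⟩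
  · rintro ⟨z, hz, hab⟩
    obtain ⟨hzp, a', b', hab', hφ⟩ := (k z).1 hz
    obtain ⟨rfl, rfl⟩ := h.pair_inj hab hab'
    have := (hprel a b).1 ⟨z, hzp, hab⟩
    exact ⟨this.1, this.2.1, hφ⟩
  · rintro ⟨ha, hb, hφ⟩
    obtain ⟨z, hz, hab⟩ := (hprel a b).2 ⟨ha, hb, trivial⟩
    exact ⟨z, (k z).2 ⟨hz, a, b, hab, hφ⟩, hab⟩

/-- An infinite set all of whose elements have a common finite support is Dedekind-infinite. -/
theorem exists_inj_of_support {X : MostowskiModel A} (hX : ¬ IsFinite X) {E : Finset A}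
    (hE : ∀ g, Fixes E g → ∀ x, x ∈ₘ X → act g x = x) : ∃ w i, IsOmega w ∧ IsInj i w X := by
  have h := isZFA (A := A)
  have := h.infinite_of_not_isFinite hX
  -- This sequence is chosen outside the model. It belongs to the model because automorphisms fixing
  -- `E` fix each of its terms as well as the numerals.
  let e := Infinite.natEmbedding {x // x ∈ₘ X}
  obtain ⟨w, hw⟩ := h.exists_omega
  obtain ⟨i, hi, hrel⟩ := exists_relation_of_invariant w X
    (fun a b => ∃ n, IsNumeral n a ∧ b = (e n).1) E (by
      rintro g hg a b ⟨n, hn, rfl⟩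
      exact ⟨n, (isNumeral_act g n a).2 hn, hE g hg _ (e n).2⟩)
  refine ⟨w, i, hw, ⟨hi, fun a ha => ?_⟩, fun a a' b hab hab' => ?_⟩
  · obtain ⟨n, hn⟩ := isNumeral_of_isNat ((hw.2 a).1 ha)
    refine ⟨(e n).1, (hrel _ _).2 ⟨ha, (e n).2, n, hn, rfl⟩, fun b hb => ?_⟩
    obtain ⟨-, -, m, hm, rfl⟩ := (hrel _ _).1 hb
    rw [h.numeral_inj hm hn]
  · obtain ⟨-, -, n, hn, rfl⟩ := (hrel _ _).1 hab
    obtain ⟨-, -, m, hm, k⟩ := (hrel _ _).1 hab'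
    obtain rfl := e.injective (Subtype.ext k)
    exact h.numeral_unique hn hm

/-! ### Failure of DF=F and proof of CRT in Mostowski's model -/

variable [Countable A] [DenselyOrdered A] [NoMinOrder A] [NoMaxOrder A] [Nonempty A]

/-- The set of all atoms is the counterexample: it is infinite, but a sequence of distinct atoms has
no finite support. -/
theorem not_dfeqf : ¬ DFeqF (MostowskiModel A) := by
  intro hD
  have h := isZFA (A := A)
  obtain ⟨X, hXs, hX⟩ := h.atoms
  have hfin := hD X hXs (by
    rintro ⟨w, f, hw, ⟨hf, hf'⟩, hinj⟩
    obtain ⟨E, hE⟩ := exists_support f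
    -- Numerals are fixed by every automorphism, so the value of f at a numeral is fixed whenever f
    -- is. An atom with this property lies in the support `E` of f.
    have key : ∀ n : ℕ, ∃ a ∈ E, ∃ k, IsNumeral n k ∧ Rel f k (atom a) := by
      intro n
      obtain ⟨k, hk⟩ := h.exists_numeral (M := MostowskiModel A) n
      have hkw := (hw.2 k).2 (h.numeral_isNat hk)
      obtain ⟨b, hb, -⟩ := hf' k hkw
      obtain ⟨a, rfl⟩ := (isAtom_iff b).1 ((hX b).1 (h.rel_mem hf hb).2)
      refine ⟨a, mem_of_forall_fixes fun g hg => ?_, k, hk, hb⟩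
      have := (rel_act g _ _ _).2 hb
      rw [hE g hg, isNumeral_unique ((isNumeral_act g n k).2 hk) hk, act_atom] at this
      exact atom_injective ((hf' k hkw).unique this hb)
    choose a haE k hk hrel using key
    have inj : Function.Injective fun n => (⟨a n, haE n⟩ : E) := fun n m e => by
      have e : a n = a m := congrArg Subtype.val e
      have := hrel n
      rw [e] at this
      exact h.numeral_inj (hinj _ _ _ this (hrel m) ▸ hk n) (hk m)
    exact not_injective_infinite_finite _ inj)
  have := finite_of_isFinite hfin
  have := Finite.of_injective (fun a : A => (⟨atom a, (hX _).2 ((isAtom_iff _).2 ⟨a, rfl⟩)⟩ :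
    {x // x ∈ₘ X})) fun a b k => atom_injective (congrArg Subtype.val k)
  exact (NoMaxOrder.infinite (α := A)).not_finite this

/-- A set with an element that has no support in `E'`, but has the support `E' ∪ {a}`, contains an
infinite linearly ordered set on which all increasing quadruples are conjugate. -/
theorem hasCanonicalSubset_of_orbit {X P C f x : MostowskiModel A}
    (hP : IsSubsetsOfSize 2 X P) (hf : IsFun f P C) (hx : x ∈ₘ X) {E : Finset A} {a : A}
    (haE : a ∉ E) (hX : ∀ g, Fixes E g → act g X = X) (hfE : ∀ g, Fixes E g → act g f = f)
    (hxa : ∀ g, Fixes E g → g a = a → act g x = x) (hxE : ∃ g, Fixes E g ∧ act g x ≠ x) :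
    HasCanonicalSubset X f := by
  have h := isZFA (A := A)
  -- The graph of the map that sends the atom g a to g x, for g fixing `E`. It is a function since
  -- `E` and a together support x, and by homogeneity its domain is the whole gap of a.
  let At : A → MostowskiModel A → Prop := fun b y => ∃ g, Fixes E g ∧ g a = b ∧ act g x = y
  have hag : a ∈ Gap E a := ⟨haE, fun _ _ => Iff.rfl⟩
  have at_gap : ∀ {b y}, At b y → b ∈ Gap E a := by
    rintro b y ⟨g, hg, rfl, -⟩
    exact apply_mem_gap hg hag
  have at_mem : ∀ {b y}, At b y → y ∈ₘ X := by
    rintro b y ⟨g, hg, -, rfl⟩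
    exact hX g hg ▸ (mem_act g).2 hx
  have at_act : ∀ {b y} g, Fixes E g → At b y → At (g b) (act g y) := by
    rintro b y k hk ⟨g, hg, rfl, rfl⟩
    exact ⟨g.trans k, hg.trans hk, rfl, (act_act _ _ _).symm⟩
  have at_self : At a x := ⟨OrderIso.refl A, fun _ _ => rfl, rfl, Subtype.ext (ASet.act_one _)⟩
  have at_unique : ∀ {b y y'}, At b y → At b y' → y = y' := by
    rintro b y y' ⟨g, hg, hgb, rfl⟩ ⟨g', hg', hgb', rfl⟩
    have := hxa (g.trans g'.symm) (hg.trans hg'.symm) (by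
      rw [OrderIso.trans_apply, hgb, ← hgb', OrderIso.symm_apply_apply])
    rw [← act_act] at this
    rw [← act_act_symm g' (act g x), this]
  have at_exists : ∀ {b}, b ∈ Gap E a → ∃ y, At b y := by
    intro b hb
    obtain ⟨g, hg, hgab⟩ := exists_fixes_of_strictMono (E := E) (a := a) (b := ![a]) (c := ![b])
      (Subsingleton.strictMono _) (Subsingleton.strictMono _) (by simpa using hag)
      (by simpa using hb)
    exact ⟨act g x, g, hg, hgab 0, rfl⟩
  -- The map is injective because `E` alone does not support x. If it took the same value at some b
  -- < b', then by homogeneity it would do so at any two points of the gap, in particular at a and k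
  -- a, and k would fix x.
  have not_lt : ∀ {b b' y}, At b y → At b' y → ¬ b < b' := by
    intro b b' y hb hb' hlt
    obtain ⟨k, hk, hkx⟩ := hxE
    apply hkx
    have hkat := at_act k hk at_self
    have pair : ∀ {c c' : A}, c ∈ Gap E a → c' ∈ Gap E a → c < c' → ∃ z, At c z ∧ At c' z := by
      intro c c' hc hc' hcc'
      obtain ⟨l, hl, hlb⟩ := exists_fixes_of_strictMono (E := E) (a := a) (b := ![b, b'])
        (c := ![c, c']) (by simpa using hlt) (by simpa using hcc')
        (by simpa [Fin.forall_fin_two] using ⟨at_gap hb, at_gap hb'⟩)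
        (by simpa [Fin.forall_fin_two] using ⟨hc, hc'⟩)
      have e0 : l b = c := hlb 0
      have e1 : l b' = c' := hlb 1
      exact ⟨act l y, e0 ▸ at_act l hl hb, e1 ▸ at_act l hl hb'⟩
    rcases lt_trichotomy a (k a) with hlt | heq | hlt
    · obtain ⟨z, hz, hz'⟩ := pair hag (at_gap hkat) hlt
      exact (at_unique hkat hz').trans (at_unique hz at_self)
    · exact at_unique (heq ▸ hkat) at_self
    · obtain ⟨z, hz, hz'⟩ := pair (at_gap hkat) hag hlt
      exact (at_unique hkat hz).trans (at_unique hz' at_self)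
  have at_inj : ∀ {b b' y}, At b y → At b' y → b = b' := fun hb hb' =>
    le_antisymm (_root_.not_lt.1 (not_lt hb' hb)) (_root_.not_lt.1 (not_lt hb hb'))
  obtain ⟨Y, hYs, hY⟩ := exists_subset_of_invariant X (fun y => ∃ b, At b y) E
    fun g hg y ⟨b, hb⟩ => ⟨g b, at_act g hg hb⟩
  have hY' : ∀ y, y ∈ₘ Y ↔ ∃ b, At b y := fun y => (hY y).trans
    (and_iff_right_of_imp fun ⟨_, hb⟩ => at_mem hb)
  obtain ⟨R, hR, hRrel⟩ := exists_relation_of_invariant Y Y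
    (fun y z => ∃ b c, At b y ∧ At c z ∧ b < c) E
    fun g hg y z ⟨b, c, hb, hc, hbc⟩ => ⟨g b, g c, at_act g hg hb, at_act g hg hc,
      g.lt_iff_lt.2 hbc⟩
  have rel_iff : ∀ {b c y z}, At b y → At c z → (Rel R y z ↔ b < c) := by
    intro b c y z hb hc
    refine (hRrel y z).trans ⟨?_, fun k => ⟨(hY' y).2 ⟨b, hb⟩, (hY' z).2 ⟨c, hc⟩, b, c, hb, hc, k⟩⟩
    rintro ⟨-, -, b', c', hb', hc', k⟩
    rwa [at_inj hb hb', at_inj hc hc']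
  have linear : IsLinearOrdering R Y := by
    refine ⟨hR, fun y k => ?_, fun y z t hyz hzt => ?_, fun y z hy hz => ?_⟩
    · obtain ⟨b, hb⟩ := (hY' y).1 (h.rel_mem hR k).1
      exact lt_irrefl b ((rel_iff hb hb).1 k)
    · obtain ⟨b, hb⟩ := (hY' y).1 (h.rel_mem hR hyz).1
      obtain ⟨c, hc⟩ := (hY' z).1 (h.rel_mem hR hyz).2
      obtain ⟨d, hd⟩ := (hY' t).1 (h.rel_mem hR hzt).2
      exact (rel_iff hb hd).2 (((rel_iff hb hc).1 hyz).trans ((rel_iff hc hd).1 hzt))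
    · obtain ⟨b, hb⟩ := (hY' y).1 hy
      obtain ⟨c, hc⟩ := (hY' z).1 hz
      rcases lt_trichotomy b c with k | rfl | k
      exacts [Or.inl ((rel_iff hb hc).2 k), Or.inr (Or.inl (at_unique hb hc)),
        Or.inr (Or.inr ((rel_iff hc hb).2 k))]
  have hYinf : ¬ IsFinite Y := by
    intro hfin
    have := finite_of_isFinite hfin
    have := infinite_gap haE
    choose y hy using fun b : Gap E a => at_exists b.2
    refine not_injective_infinite_finite
      (fun b : Gap E a => (⟨y b, (hY' _).2 ⟨b.1, hy b⟩⟩ : {y // y ∈ₘ Y})) fun b c e => ?_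
    have e : y b = y c := congrArg Subtype.val e
    exact Subtype.ext (at_inj (hy b) (e ▸ hy c))
  -- Any two increasing quadruples of the orbit correspond to increasing quadruples of the gap, and
  -- these are conjugate over `E`. Every relation invariant over `E` therefore treats them alike.
  have hom : ∀ φ : MostowskiModel A → MostowskiModel A → MostowskiModel A → MostowskiModel A → Prop,
      (∀ g, Fixes E g → ∀ y₁ y₂ y₃ y₄, φ y₁ y₂ y₃ y₄ →
        φ (act g y₁) (act g y₂) (act g y₃) (act g y₄)) → HomOn (Rel R) Y φ := by
    intro φ hφ y₁ y₂ y₃ y₄ z₁ z₂ z₃ z₄ hy₁ hy₂ hy₃ hy₄ hz₁ hz₂ hz₃ hz₄ h₁ h₂ h₃ k₁ k₂ k₃ H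
    obtain ⟨b₁, hb₁⟩ := (hY' _).1 hy₁
    obtain ⟨b₂, hb₂⟩ := (hY' _).1 hy₂
    obtain ⟨b₃, hb₃⟩ := (hY' _).1 hy₃
    obtain ⟨b₄, hb₄⟩ := (hY' _).1 hy₄
    obtain ⟨c₁, hc₁⟩ := (hY' _).1 hz₁
    obtain ⟨c₂, hc₂⟩ := (hY' _).1 hz₂
    obtain ⟨c₃, hc₃⟩ := (hY' _).1 hz₃
    obtain ⟨c₄, hc₄⟩ := (hY' _).1 hz₄
    obtain ⟨g, hg, hgbc⟩ := exists_fixes_of_strictMono (E := E) (a := a)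
      (strictMono_quadruple ((rel_iff hb₁ hb₂).1 h₁) ((rel_iff hb₂ hb₃).1 h₂)
        ((rel_iff hb₃ hb₄).1 h₃))
      (strictMono_quadruple ((rel_iff hc₁ hc₂).1 k₁) ((rel_iff hc₂ hc₃).1 k₂)
        ((rel_iff hc₃ hc₄).1 k₃))
      (by simpa [Fin.forall_fin_succ] using ⟨at_gap hb₁, at_gap hb₂, at_gap hb₃, at_gap hb₄⟩)
      (by simpa [Fin.forall_fin_succ] using ⟨at_gap hc₁, at_gap hc₂, at_gap hc₃, at_gap hc₄⟩)
    have move : ∀ {b c y z}, At b y → At c z → g b = c → act g y = z := by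
      rintro b c y z hb hc rfl
      exact at_unique (at_act g hg hb) hc
    have := hφ g hg _ _ _ _ H
    rwa [move hb₁ hc₁ (hgbc 0), move hb₂ hc₂ (hgbc 1), move hb₃ hc₃ (hgbc 2),
      move hb₄ hc₄ (hgbc 3)] at this
  have color : ∀ g, Fixes E g → ∀ y₁ y₂ y₃ y₄, SameColor f y₁ y₂ y₃ y₄ →
      SameColor f (act g y₁) (act g y₂) (act g y₃) (act g y₄) := by
    intro g hg y₁ y₂ y₃ y₄ k
    have := (sameColor_act g _ _ _ _ _).2 k
    rwa [hfE g hg] at this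
  refine h.hasCanonicalSubset_of_patternOn hP hf hYs (fun y hy => ((hY y).1 hy).1) hYinf linear
    ⟨?_, ?_, ?_, ?_, ?_, ?_⟩
  all_goals exact hom _ fun g hg _ _ _ _ => color g hg _ _ _ _

/-- Either all elements of X share the support of X and f, and the theorem for Dedekind-infinite
sets applies, or some element genuinely depends on a further atom, which parametrizes a suitable
orbit. -/
theorem crt : CRT (MostowskiModel A) := by
  classical
  intro X P C f hXs hX hP _ hf
  have h := isZFA (A := A)
  obtain ⟨E₁, hE₁⟩ := exists_support X
  obtain ⟨E₂, hE₂⟩ := exists_support f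
  by_cases hc : ∀ g, Fixes (E₁ ∪ E₂) g → ∀ x, x ∈ₘ X → act g x = x
  · obtain ⟨w, i, hw, hi⟩ := exists_inj_of_support hX hc
    exact h.hasCanonicalSubset_of_inj hw hi hP hf
  · push Not at hc
    obtain ⟨g, hg, x, hx, hgx⟩ := hc
    obtain ⟨F, hF⟩ := exists_support x
    -- A support of x of least size among those containing the supports of X and f. By minimality,
    -- dropping the extra atom a leaves a finite set that no longer supports x.
    have hS : ∃ n, ∃ S : Finset A, S.card = n ∧ E₁ ∪ E₂ ⊆ S ∧ ∀ g, Fixes S g → act g x = x :=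
      ⟨_, F ∪ (E₁ ∪ E₂), rfl, Finset.subset_union_right,
        fun g hg => hF g (hg.mono Finset.subset_union_left)⟩
    obtain ⟨S, hcard, hES, hSx⟩ := Nat.find_spec hS
    have hne : ∃ a ∈ S, a ∉ E₁ ∪ E₂ := by
      by_contra! hsub
      exact hgx (hSx g fun a ha => hg a (hsub a ha))
    obtain ⟨a, haS, haE⟩ := hne
    have hE : E₁ ∪ E₂ ⊆ S.erase a := fun e he =>
      Finset.mem_erase.2 ⟨fun k => haE (k ▸ he), hES he⟩
    refine hasCanonicalSubset_of_orbit hP hf hx (Finset.notMem_erase a S)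
      (fun g hg => hE₁ g (hg.mono (Finset.subset_union_left.trans hE)))
      (fun g hg => hE₂ g (hg.mono (Finset.subset_union_right.trans hE)))
      (fun g hg hga => hSx g fun b hb => ?_) ?_
    · by_cases hba : b = a
      · rw [hba, hga]
      · exact hg b (Finset.mem_erase.2 ⟨hba, hb⟩)
    · by_contra! hcon
      refine Nat.find_min hS (m := (S.erase a).card) ?_ ⟨S.erase a, rfl, hE, hcon⟩
      rw [← hcard]
      exact Finset.card_erase_lt_of_mem haS

end MostowskiModel

/-! ### The theorem -/

theorem theorem4p9 :
    -- in ZF, the Ordering Principle and Ramsey's Theorem for 4-sets and 203 colors imply CRT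
    (∀ (M : Type u) [SetStructure M], SetStructure.IsZF M →
      SetStructure.OP M → SetStructure.RT M 4 203 → SetStructure.CRT M) ∧
    -- in ZFA, `DF = F` implies CRT
    (∀ (M : Type u) [SetStructure M], SetStructure.IsZFA M →
      SetStructure.DFeqF M → SetStructure.CRT M) ∧
    -- Mostowski's model satisfies ZFA and CRT, but not `DF = F`
    (∀ (A : Type v) [LinearOrder A], Nonempty (A ≃o ℚ) →
      SetStructure.IsZFA (MostowskiModel A) ∧ SetStructure.CRT (MostowskiModel A) ∧
        ¬ SetStructure.DFeqF (MostowskiModel A)) := by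
  refine ⟨fun M _ h hOP hRT => h.1.crt_of_op_of_rt (by norm_num) hOP hRT,
    fun M _ h hD => h.crt_of_dfeqf hD, fun A _ ⟨e⟩ => ?_⟩
  have : Countable A := e.toEquiv.countable_iff.2 inferInstance
  have : Nonempty A := ⟨e.symm 0⟩
  have : DenselyOrdered A := ⟨fun a b hab => by
    obtain ⟨q, h1, h2⟩ := exists_between (e.lt_iff_lt.2 hab)
    exact ⟨e.symm q, e.lt_symm_apply.2 h1, e.symm_apply_lt.2 h2⟩⟩
  have : NoMinOrder A := ⟨fun a => by
    obtain ⟨q, hq⟩ := exists_lt (e a)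
    exact ⟨e.symm q, e.symm_apply_lt.2 hq⟩⟩
  have : NoMaxOrder A := ⟨fun a => by
    obtain ⟨q, hq⟩ := exists_gt (e a)
    exact ⟨e.symm q, e.lt_symm_apply.2 hq⟩⟩
  exact ⟨MostowskiModel.isZFA, MostowskiModel.crt, MostowskiModel.not_dfeqf⟩
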